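/- **Setting.** Let $\Sigma$ be an alphabet. State formulas $\phi$ and path formulas $\psi$ of $\mathrm{CTL}^*[\exists,\forall,\mathbb P_{>0},\mathbb P_{=1}]$ over $\Sigma$ are generated by $$\phi ::= \top \mid \bot \mid a\in\Sigma \mid \phi\wedge\phi \mid \phi\vee\phi\mid\neg\phi\mid \exists\psi\mid\forall\psi\mid\mathbb P_{>0}(\psi)\mid\mathbb P_{=1}(\psi),$$ $$\psi ::= \phi\mid\neg\psi\mid\psi\wedge\psi\mid\psi\vee\psi\mid X\psi\mid\psi\,U\,\psi\mid G\psi .$$ A formula means a state formula. A Markov chain $\mathcal M=(S,p,t)$ with alphabet $\Sigma$ has a countable set $S$ of states, transition probabilities $p(s,\cdot)$ (a probability distribution on $S$ for each $s\in S$) and a labelling $t:S\to\Sigma$; $\mathbb P_{\mathcal M,s}$ is the law on $S^\omega$ of the chain started in $s$. An infinite path from $s$ is a sequence $s_0s_1\cdots\in S^\omega$ with $s_0=s$ and $p(s_n,s_{n+1})>0$ for all $n$. Satisfaction is as usual: $s\models a$ iff $t(s)=a$; $s\models\exists\psi$ (resp. $\forall\psi$) iff some (resp. every) infinite path from $s$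 satisfies $\psi$; $s\models\mathbb P_{>0}(\psi)$ (resp. $\mathbb P_{=1}(\psi)$) iff the set of infinite paths from $s$ satisfying $\psi$ has $\mathbb P_{\mathcal M,s}$-probability $>0$ (resp. $=1$); path formulas are interpreted on infinite paths as in LTL, a state formula being evaluated at the first state of the path. A binary tree $t:\{0,1\}^*\to\Sigma$ is the Markov chain on $\{0,1\}^*$ that moves from a node $n$ to $n0$ and to $n1$ with probability $\frac12$ each; it satisfies a formula if its root does. The size of a formula is its number of symbols, and its DAG-size is its number of distinct subformulas. **Theorem.** There is a constant $C$ such that for every alphabet $\Sigma$ and every fresh letter $\circ\notin\Sigma$ there is a transformation $\phi\mapsto\phi'$ of formulas of $\mathrm{CTL}^*[\exists,\forall,\mathbb P_{>0},\mathbb P_{=1}]$ over $\Sigma$ into formulas over $\Sigma\cup\{\circ\}$ with the following properties. 1. (Effectiveness, in linear time.) If $\Sigma$ is finite, then the transformation is computed by a Turing machine with several stacks which, on a formula written in prefix notation as a word of length $n$, halts after at most $C(n+1)$ steps. 2. (Linear size.) The size of $\phi'$ is at most $C$ times that of $\phi$, and the DAG-size of $\phi'$ is at most $C$ times that of $\phi$.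 3. (Reduction.) $\phi$ is satisfied at some state of some Markov chain with alphabet $\Sigma$ if and only if $\phi'$ is satisfied by some $\Sigma\cup\{\circ\}$-labelled binary tree. With 1, satisfiability by Markov chains thus reduces in linear time to satisfiability by binary trees. 4. (Fragment.) If neither $\exists$ nor $\forall$ occurs in $\phi$, then neither occurs in $\phi'$; that is, the fragment $\mathrm{CTL}^*[\mathbb P_{>0},\mathbb P_{=1}]$ is stabilized. -/

import Mathlib

open MeasureTheory ProbabilityTheory

namespace CTLStar

/-! ### Syntax of CTL*[∃, ∀, P>0, P=1] -/

mutual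

/-- State formulas over the alphabet `A`. -/
inductive StateFormula (A : Type) : Type
  | top : StateFormula A
  | bot : StateFormula A
  | letter (a : A) : StateFormula A
  | and (φ₁ φ₂ : StateFormula A) : StateFormula A
  | or (φ₁ φ₂ : StateFormula A) : StateFormula A
  | not (φ : StateFormula A) : StateFormula A
  | ex (ψ : PathFormula A) : StateFormula A
  | all (ψ : PathFormula A) : StateFormula A
  | probPos (ψ : PathFormula A) : StateFormula A
  | probOne (ψ : PathFormula A) : StateFormula A

/-- Path formulas over the alphabet `A`; `state` is the inclusion of state formulas. -/
inductive PathFormula (A : Type) : Type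
  | state (φ : StateFormula A) : PathFormula A
  | not (ψ : PathFormula A) : PathFormula A
  | and (ψ₁ ψ₂ : PathFormula A) : PathFormula A
  | or (ψ₁ ψ₂ : PathFormula A) : PathFormula A
  | next (ψ : PathFormula A) : PathFormula A
  | untl (ψ₁ ψ₂ : PathFormula A) : PathFormula A
  | always (ψ : PathFormula A) : PathFormula A

end

/-! ### Markov chains and their path measures -/

/-- Transition probabilities and labelling of a Markov chain with alphabet `A` and state
space `S`; countability of `S` is required where chains serve as models. -/
structure MarkovChain (S A : Type) where
  /-- transition probabilities -/
  p : S → PMF S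
  /-- labelling function -/
  label : S → A

namespace MarkovChain

variable {S A : Type}

/-- The transition kernel at time `n`: the next state depends only on the present one. -/
noncomputable def kernel [MeasurableSpace S] [DiscreteMeasurableSpace S]
    (M : MarkovChain S A) (n : ℕ) : Kernel (Finset.Iic n → S) S where
  toFun x := (M.p (x ⟨n, Finset.mem_Iic.2 le_rfl⟩)).toMeasure
  measurable' := (Measurable.of_discrete (f := fun s => (M.p s).toMeasure)).comp
    (measurable_pi_apply _)

instance [MeasurableSpace S] [DiscreteMeasurableSpace S] (M : MarkovChain S A) (n : ℕ) :
    IsMarkovKernel (M.kernel n) :=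
  ⟨fun x => PMF.toMeasure.isProbabilityMeasure (M.p (x ⟨n, Finset.mem_Iic.2 le_rfl⟩))⟩

/-- The law on `S^ω` of the chain started in `s`. -/
noncomputable def pathMeasure [MeasurableSpace S] [DiscreteMeasurableSpace S]
    (M : MarkovChain S A) (s : S) : Measure (ℕ → S) :=
  Kernel.traj (X := fun _ => S) M.kernel 0 (fun _ => s)

/-- `ℙ_{M,s}(E)`, where `S` carries the discrete σ-algebra and `S^ω` the product one. -/
noncomputable def prob (M : MarkovChain S A) (s : S) (E : Set (ℕ → S)) : ENNReal :=
  letI : MeasurableSpace S := ⊤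
  haveI : DiscreteMeasurableSpace S := ⟨fun _ => trivial⟩
  M.pathMeasure s E

/-- `w` is an infinite path of `M` starting in `s`. -/
def IsPath (M : MarkovChain S A) (s : S) (w : ℕ → S) : Prop :=
  w 0 = s ∧ ∀ n, 0 < M.p (w n) (w (n + 1))

end MarkovChain

/-! ### Semantics -/

mutual

/-- `M, s ⊨ φ`. -/
def StateFormula.Sat {S A : Type} (M : MarkovChain S A) : StateFormula A → S → Prop
  | .top, _ => True
  | .bot, _ => False
  | .letter a, s => M.label s = a
  | .and φ₁ φ₂, s => φ₁.Sat M s ∧ φ₂.Sat M s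
  | .or φ₁ φ₂, s => φ₁.Sat M s ∨ φ₂.Sat M s
  | .not φ, s => ¬ φ.Sat M s
  | .ex ψ, s => ∃ w, M.IsPath s w ∧ ψ.Sat M w
  | .all ψ, s => ∀ w, M.IsPath s w → ψ.Sat M w
  | .probPos ψ, s => 0 < M.prob s {w | M.IsPath s w ∧ ψ.Sat M w}
  | .probOne ψ, s => M.prob s {w | M.IsPath s w ∧ ψ.Sat M w} = 1

/-- `M, w ⊨ ψ` for an infinite path `w`; the suffix `w[k]` is `fun i => w (k + i)`. -/
def PathFormula.Sat {S A : Type} (M : MarkovChain S A) : PathFormula A → (ℕ → S) → Prop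
  | .state φ, w => φ.Sat M (w 0)
  | .not ψ, w => ¬ ψ.Sat M w
  | .and ψ₁ ψ₂, w => ψ₁.Sat M w ∧ ψ₂.Sat M w
  | .or ψ₁ ψ₂, w => ψ₁.Sat M w ∨ ψ₂.Sat M w
  | .next ψ, w => ψ.Sat M (fun i => w (1 + i))
  | .untl ψ₁ ψ₂, w => ∃ n, (∀ k < n, ψ₁.Sat M (fun i => w (k + i))) ∧
      ψ₂.Sat M (fun i => w (n + i))
  | .always ψ, w => ∀ k, ψ.Sat M (fun i => w (k + i))

end

/-- `φ` has a model: a state of a Markov chain with countably many states. -/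
def MCSat {A : Type} (φ : StateFormula A) : Prop :=
  ∃ (S : Type) (_ : Countable S) (M : MarkovChain S A) (s : S), φ.Sat M s

/-- The `A`-labelled binary tree `t`, seen as a Markov chain: from the node `n` the two sons
`n0` and `n1` are reached with probability `1/2` each. -/
noncomputable def treeChain {A : Type} (t : List Bool → A) : MarkovChain (List Bool) A where
  p n := (PMF.uniformOfFintype Bool).map (fun b => n ++ [b])
  label := t

/-- `φ` is satisfied at the root of some binary tree. -/
def BinSat {A : Type} (φ : StateFormula A) : Prop :=
  ∃ t : List Bool → A, φ.Sat (treeChain t) []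

/-! ### The fragment without `∃` and `∀` -/

mutual

/-- The formula belongs to CTL*[P>0, P=1]: the quantifiers `∃`, `∀` do not occur in it. -/
def StateFormula.Qualitative {A : Type} : StateFormula A → Prop
  | .top => True
  | .bot => True
  | .letter _ => True
  | .and φ₁ φ₂ => φ₁.Qualitative ∧ φ₂.Qualitative
  | .or φ₁ φ₂ => φ₁.Qualitative ∧ φ₂.Qualitative
  | .not φ => φ.Qualitative
  | .ex _ => False
  | .all _ => False
  | .probPos ψ => ψ.Qualitative
  | .probOne ψ => ψ.Qualitative

/-- The quantifiers `∃`, `∀` do not occur in the path formula. -/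
def PathFormula.Qualitative {A : Type} : PathFormula A → Prop
  | .state φ => φ.Qualitative
  | .not ψ => ψ.Qualitative
  | .and ψ₁ ψ₂ => ψ₁.Qualitative ∧ ψ₂.Qualitative
  | .or ψ₁ ψ₂ => ψ₁.Qualitative ∧ ψ₂.Qualitative
  | .next ψ => ψ.Qualitative
  | .untl ψ₁ ψ₂ => ψ₁.Qualitative ∧ ψ₂.Qualitative
  | .always ψ => ψ.Qualitative

end

/-! ### Size of formulas, as trees and as DAGs -/

mutual

/-- Number of occurrences of letters, constants, connectives, operators and quantifiers. -/
def StateFormula.size {A : Type} : StateFormula A → ℕ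
  | .top => 1
  | .bot => 1
  | .letter _ => 1
  | .and φ₁ φ₂ => φ₁.size + φ₂.size + 1
  | .or φ₁ φ₂ => φ₁.size + φ₂.size + 1
  | .not φ => φ.size + 1
  | .ex ψ => ψ.size + 1
  | .all ψ => ψ.size + 1
  | .probPos ψ => ψ.size + 1
  | .probOne ψ => ψ.size + 1

/-- Number of occurrences of letters, constants, connectives, operators and quantifiers. -/
def PathFormula.size {A : Type} : PathFormula A → ℕ
  | .state φ => φ.size
  | .not ψ => ψ.size + 1
  | .and ψ₁ ψ₂ => ψ₁.size + ψ₂.size + 1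
  | .or ψ₁ ψ₂ => ψ₁.size + ψ₂.size + 1
  | .next ψ => ψ.size + 1
  | .untl ψ₁ ψ₂ => ψ₁.size + ψ₂.size + 1
  | .always ψ => ψ.size + 1

end

mutual

/-- The subformulas (of both kinds) of a state formula, itself included. -/
def StateFormula.subs {A : Type} : StateFormula A → Set (StateFormula A ⊕ PathFormula A)
  | .top => {.inl .top}
  | .bot => {.inl .bot}
  | .letter a => {.inl (.letter a)}
  | .and φ₁ φ₂ => insert (.inl (.and φ₁ φ₂)) (φ₁.subs ∪ φ₂.subs)
  | .or φ₁ φ₂ => insert (.inl (.or φ₁ φ₂)) (φ₁.subs ∪ φ₂.subs)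
  | .not φ => insert (.inl (.not φ)) φ.subs
  | .ex ψ => insert (.inl (.ex ψ)) ψ.subs
  | .all ψ => insert (.inl (.all ψ)) ψ.subs
  | .probPos ψ => insert (.inl (.probPos ψ)) ψ.subs
  | .probOne ψ => insert (.inl (.probOne ψ)) ψ.subs

/-- The subformulas (of both kinds) of a path formula, itself included. -/
def PathFormula.subs {A : Type} : PathFormula A → Set (StateFormula A ⊕ PathFormula A)
  | .state φ => insert (.inr (.state φ)) φ.subs
  | .not ψ => insert (.inr (.not ψ)) ψ.subs
  | .and ψ₁ ψ₂ => insert (.inr (.and ψ₁ ψ₂)) (ψ₁.subs ∪ ψ₂.subs)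
  | .or ψ₁ ψ₂ => insert (.inr (.or ψ₁ ψ₂)) (ψ₁.subs ∪ ψ₂.subs)
  | .next ψ => insert (.inr (.next ψ)) ψ.subs
  | .untl ψ₁ ψ₂ => insert (.inr (.untl ψ₁ ψ₂)) (ψ₁.subs ∪ ψ₂.subs)
  | .always ψ => insert (.inr (.always ψ)) ψ.subs

end

/-- The size of a formula represented as a DAG: the number of its distinct subformulas
(a finite set for every formula). -/
noncomputable def StateFormula.dagSize {A : Type} (φ : StateFormula A) : ℕ :=
  φ.subs.ncard

/-! ### Formulas as words, and linear-time computability -/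

/-- The symbols of which formulas over the alphabet `A` are written. The Boolean connectives
of state formulas and those of path formulas are different symbols. -/
inductive Symb (A : Type) : Type
  | top | bot
  | letter (a : A)
  | sAnd | sOr | sNot
  | ex | all | probPos | probOne
  | pNot | pAnd | pOr | next | untl | always

mutual

/-- A state formula written as a word, in prefix (Polish) notation. -/
def StateFormula.word {A : Type} : StateFormula A → List (Symb A)
  | .top => [.top]
  | .bot => [.bot]
  | .letter a => [.letter a]
  | .and φ₁ φ₂ => .sAnd :: (φ₁.word ++ φ₂.word)
  | .or φ₁ φ₂ => .sOr :: (φ₁.word ++ φ₂.word)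
  | .not φ => .sNot :: φ.word
  | .ex ψ => .ex :: ψ.word
  | .all ψ => .all :: ψ.word
  | .probPos ψ => .probPos :: ψ.word
  | .probOne ψ => .probOne :: ψ.word

/-- A path formula written as a word, in prefix (Polish) notation. -/
def PathFormula.word {A : Type} : PathFormula A → List (Symb A)
  | .state φ => φ.word
  | .not ψ => .pNot :: ψ.word
  | .and ψ₁ ψ₂ => .pAnd :: (ψ₁.word ++ ψ₂.word)
  | .or ψ₁ ψ₂ => .pOr :: (ψ₁.word ++ ψ₂.word)
  | .next ψ => .next :: ψ.word
  | .untl ψ₁ ψ₂ => .untl :: (ψ₁.word ++ ψ₂.word)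
  | .always ψ => .always :: ψ.word

end

/-- A multi-stack Turing machine computes `f` on words, within `C * (n + 1)` steps on every
formula whose word has length `n`. -/
def ComputableInLinearTime {A B : Type} (f : StateFormula A → StateFormula B) (C : ℕ) : Prop :=
  ∃ T : Turing.TM2ComputableInTime
      (StateFormula.word (A := A)) (StateFormula.word (A := B)) f,
    ∀ n, T.time n ≤ C * (n + 1)

end CTLStar

namespace CTLStar

/-! ### The translation -/

/-- The formula holding at the nodes that do not carry the fresh letter. -/
def nonBlank {A : Type} : StateFormula (Option A) := .not (.letter none)

/-- The path formula holding at the nodes that carry the fresh letter. -/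
def blankPath {A : Type} : PathFormula (Option A) := .state (.letter none)

/-- Infinitely many positions do not carry the fresh letter. -/
def recurNonBlank {A : Type} : PathFormula (Option A) :=
  .always (.untl (.state .top) (.state nonBlank))

mutual

/-- Relativization of a state formula to the nodes without the fresh letter. -/
def StateFormula.relativize {A : Type} : StateFormula A → StateFormula (Option A)
  | .top => nonBlank
  | .bot => .bot
  | .letter a => .letter (some a)
  | .and φ₁ φ₂ => .and φ₁.relativize φ₂.relativize
  | .or φ₁ φ₂ => .or φ₁.relativize φ₂.relativize
  | .not φ => .and nonBlank (.not φ.relativize)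
  | .ex ψ => .and nonBlank (.ex (.and recurNonBlank ψ.relativize))
  | .all ψ => .and nonBlank (.all (.or (.not recurNonBlank) ψ.relativize))
  | .probPos ψ => .and nonBlank (.probPos ψ.relativize)
  | .probOne ψ => .and nonBlank (.probOne ψ.relativize)

/-- Relativization of a path formula to the positions without the fresh letter. -/
def PathFormula.relativize {A : Type} : PathFormula A → PathFormula (Option A)
  | .state φ => .state φ.relativize
  | .not ψ => .and (.state nonBlank) (.not ψ.relativize)
  | .and ψ₁ ψ₂ => .and ψ₁.relativize ψ₂.relativize
  | .or ψ₁ ψ₂ => .or ψ₁.relativize ψ₂.relativize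
  | .next ψ => .and (.state nonBlank) (.next (.untl blankPath ψ.relativize))
  | .untl ψ₁ ψ₂ => .and (.state nonBlank) (.untl (.or blankPath ψ₁.relativize) ψ₂.relativize)
  | .always ψ => .and (.state nonBlank) (.always (.or blankPath ψ.relativize))

end

/-- The reduction from Markov chains to binary trees. -/
def StateFormula.toTree {A : Type} (φ : StateFormula A) : StateFormula (Option A) :=
  .and (.probOne recurNonBlank) φ.relativize

mutual

theorem StateFormula.Qualitative.relativize {A : Type} :
    ∀ φ : StateFormula A, φ.Qualitative → φ.relativize.Qualitative
  | .top, _ => trivial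
  | .bot, _ => trivial
  | .letter _, _ => trivial
  | .and φ₁ φ₂, h => ⟨StateFormula.Qualitative.relativize φ₁ h.1,
      StateFormula.Qualitative.relativize φ₂ h.2⟩
  | .or φ₁ φ₂, h => ⟨StateFormula.Qualitative.relativize φ₁ h.1,
      StateFormula.Qualitative.relativize φ₂ h.2⟩
  | .not φ, h => ⟨trivial, StateFormula.Qualitative.relativize φ h⟩
  | .ex _, h => h.elim
  | .all _, h => h.elim
  | .probPos ψ, h => ⟨trivial, PathFormula.Qualitative.relativize ψ h⟩
  | .probOne ψ, h => ⟨trivial, PathFormula.Qualitative.relativize ψ h⟩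

theorem PathFormula.Qualitative.relativize {A : Type} :
    ∀ ψ : PathFormula A, ψ.Qualitative → ψ.relativize.Qualitative
  | .state φ, h => StateFormula.Qualitative.relativize φ h
  | .not ψ, h => ⟨trivial, PathFormula.Qualitative.relativize ψ h⟩
  | .and ψ₁ ψ₂, h => ⟨PathFormula.Qualitative.relativize ψ₁ h.1,
      PathFormula.Qualitative.relativize ψ₂ h.2⟩
  | .or ψ₁ ψ₂, h => ⟨PathFormula.Qualitative.relativize ψ₁ h.1,
      PathFormula.Qualitative.relativize ψ₂ h.2⟩
  | .next ψ, h => ⟨trivial, trivial, PathFormula.Qualitative.relativize ψ h⟩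
  | .untl ψ₁ ψ₂, h =>
      ⟨trivial, ⟨trivial, PathFormula.Qualitative.relativize ψ₁ h.1⟩,
          PathFormula.Qualitative.relativize ψ₂ h.2⟩
  | .always ψ, h => ⟨trivial, trivial, PathFormula.Qualitative.relativize ψ h⟩

end

theorem StateFormula.Qualitative.toTree {A : Type} {φ : StateFormula A} (h : φ.Qualitative) :
    φ.toTree.Qualitative :=
  ⟨⟨trivial, trivial⟩, h.relativize⟩

/-! ### Size -/

mutual

theorem StateFormula.size_relativize_le {A : Type} :
    ∀ φ : StateFormula A, φ.relativize.size ≤ 11 * φ.size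
  | .top | .bot | .letter _ => by
    simp [StateFormula.relativize, StateFormula.size, nonBlank]
  | .and φ₁ φ₂ | .or φ₁ φ₂ => by
    have := StateFormula.size_relativize_le φ₁
    have := StateFormula.size_relativize_le φ₂
    simp only [StateFormula.relativize, StateFormula.size]; omega
  | .not φ => by
    have := StateFormula.size_relativize_le φ
    simp only [StateFormula.relativize, StateFormula.size, nonBlank]; omega
  | .ex ψ | .all ψ | .probPos ψ | .probOne ψ => by
    have := PathFormula.size_relativize_le ψ
    simp only [StateFormula.relativize, StateFormula.size, PathFormula.size, nonBlank,
      recurNonBlank]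
    omega

theorem PathFormula.size_relativize_le {A : Type} :
    ∀ ψ : PathFormula A, ψ.relativize.size ≤ 11 * ψ.size
  | .state φ => StateFormula.size_relativize_le φ
  | .and ψ₁ ψ₂ | .or ψ₁ ψ₂ | .untl ψ₁ ψ₂ => by
    have := PathFormula.size_relativize_le ψ₁
    have := PathFormula.size_relativize_le ψ₂
    simp only [PathFormula.relativize, StateFormula.size, PathFormula.size, nonBlank, blankPath]
    omega
  | .not ψ | .next ψ | .always ψ => by
    have := PathFormula.size_relativize_le ψ
    simp only [PathFormula.relativize, StateFormula.size, PathFormula.size, nonBlank, blankPath]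
    omega

end

theorem StateFormula.size_pos {A : Type} (φ : StateFormula A) : 0 < φ.size := by
  cases φ <;> simp [StateFormula.size]

theorem StateFormula.size_toTree_le {A : Type} (φ : StateFormula A) :
    φ.toTree.size ≤ 20 * φ.size := by
  have h := φ.size_relativize_le
  have := φ.size_pos
  simp only [StateFormula.toTree, StateFormula.size, PathFormula.size, recurNonBlank, nonBlank]
  omega

/-! ### DAG-size -/

mutual

theorem StateFormula.finite_subs {A : Type} : ∀ φ : StateFormula A, φ.subs.Finite
  | .top | .bot | .letter _ => Set.finite_singleton _
  | .and φ₁ φ₂ | .or φ₁ φ₂ =>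
      ((StateFormula.finite_subs φ₁).union (StateFormula.finite_subs φ₂)).insert _
  | .not φ => (StateFormula.finite_subs φ).insert _
  | .ex ψ | .all ψ | .probPos ψ | .probOne ψ => (PathFormula.finite_subs ψ).insert _

theorem PathFormula.finite_subs {A : Type} : ∀ ψ : PathFormula A, ψ.subs.Finite
  | .state φ => (StateFormula.finite_subs φ).insert _
  | .and ψ₁ ψ₂ | .or ψ₁ ψ₂ | .untl ψ₁ ψ₂ =>
      ((PathFormula.finite_subs ψ₁).union (PathFormula.finite_subs ψ₂)).insert _
  | .not ψ | .next ψ | .always ψ => (PathFormula.finite_subs ψ).insert _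

end

/-- The subformulas shared by all relativizations. -/
def sharedSubs {A : Type} : List (StateFormula (Option A) ⊕ PathFormula (Option A)) :=
  [.inl (.letter none), .inl nonBlank, .inr (.state nonBlank), .inl .top, .inr (.state .top),
   .inr (.untl (.state .top) (.state nonBlank)), .inr recurNonBlank, .inr (.not recurNonBlank),
   .inr blankPath]

/-- The subformulas of a relativization that are contributed by the outermost symbol. -/
def ownSubs {A : Type} :
    StateFormula A ⊕ PathFormula A → List (StateFormula (Option A) ⊕ PathFormula (Option A))
  | .inl (.not φ) => [.inl (StateFormula.not φ).relativize, .inl (.not φ.relativize)]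
  | .inl (.ex ψ) => [.inl (StateFormula.ex ψ).relativize,
      .inl (.ex (.and recurNonBlank ψ.relativize)), .inr (.and recurNonBlank ψ.relativize)]
  | .inl (.all ψ) => [.inl (StateFormula.all ψ).relativize,
      .inl (.all (.or (.not recurNonBlank) ψ.relativize)),
      .inr (.or (.not recurNonBlank) ψ.relativize)]
  | .inl (.probPos ψ) => [.inl (StateFormula.probPos ψ).relativize, .inl (.probPos ψ.relativize)]
  | .inl (.probOne ψ) => [.inl (StateFormula.probOne ψ).relativize, .inl (.probOne ψ.relativize)]
  | .inl φ => [.inl φ.relativize]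
  | .inr (.not ψ) => [.inr (PathFormula.not ψ).relativize, .inr (.not ψ.relativize)]
  | .inr (.next ψ) => [.inr (PathFormula.next ψ).relativize,
      .inr (.next (.untl blankPath ψ.relativize)), .inr (.untl blankPath ψ.relativize)]
  | .inr (.untl ψ₁ ψ₂) => [.inr (PathFormula.untl ψ₁ ψ₂).relativize,
      .inr (.untl (.or blankPath ψ₁.relativize) ψ₂.relativize),
      .inr (.or blankPath ψ₁.relativize)]
  | .inr (.always ψ) => [.inr (PathFormula.always ψ).relativize,
      .inr (.always (.or blankPath ψ.relativize)), .inr (.or blankPath ψ.relativize)]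
  | .inr ψ => [.inr ψ.relativize]

/-- A set containing the subformulas of the relativization of a formula with subformulas `s`. -/
def subsBound {A : Type} (s : Set (StateFormula A ⊕ PathFormula A)) :
    Set (StateFormula (Option A) ⊕ PathFormula (Option A)) :=
  {y | y ∈ sharedSubs ∨ ∃ x ∈ s, y ∈ ownSubs x}

theorem subsBound_mono {A : Type} {s t : Set (StateFormula A ⊕ PathFormula A)} (h : s ⊆ t) :
    subsBound s ⊆ subsBound t := by
  rintro y (hy | ⟨x, hx, hy⟩)
  · exact Or.inl hy
  · exact Or.inr ⟨x, h hx, hy⟩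

mutual

theorem StateFormula.subs_relativize_subset {A : Type} :
    ∀ φ : StateFormula A, φ.relativize.subs ⊆ subsBound φ.subs
  | .top | .bot | .letter _ => by
    intro y hy
    simp [StateFormula.relativize, StateFormula.subs, nonBlank, subsBound, sharedSubs,
      ownSubs] at hy ⊢
    tauto
  | .and φ₁ φ₂ | .or φ₁ φ₂ => by
    have h₁ := StateFormula.subs_relativize_subset φ₁
    have h₂ := StateFormula.subs_relativize_subset φ₂
    simp only [StateFormula.relativize, StateFormula.subs, Set.insert_subset_iff,
      Set.union_subset_iff]
    refine ⟨Or.inr ⟨_, Set.mem_insert _ _, by simp [ownSubs, StateFormula.relativize]⟩,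
      h₁.trans (subsBound_mono ?_), h₂.trans (subsBound_mono ?_)⟩
    · exact fun x hx => Or.inr (Or.inl hx)
    · exact fun x hx => Or.inr (Or.inr hx)
  | .not φ => by
    have h₁ := StateFormula.subs_relativize_subset φ
    simp only [StateFormula.relativize, StateFormula.subs, nonBlank, Set.insert_subset_iff,
      Set.union_subset_iff, Set.singleton_subset_iff]
    refine ⟨Or.inr ⟨_, Set.mem_insert _ _, ?_⟩, ⟨Or.inl ?_, Or.inl ?_⟩,
      Or.inr ⟨_, Set.mem_insert _ _, ?_⟩, h₁.trans (subsBound_mono (Set.subset_insert _ _))⟩ <;>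
      simp [ownSubs, sharedSubs, StateFormula.relativize, nonBlank]
  | .ex ψ | .all ψ | .probPos ψ | .probOne ψ => by
    have h₁ := PathFormula.subs_relativize_subset ψ
    have h₂ := h₁.trans (subsBound_mono
      (Set.subset_insert (Sum.inl (StateFormula.ex ψ)) ψ.subs))
    have h₃ := h₁.trans (subsBound_mono
      (Set.subset_insert (Sum.inl (StateFormula.all ψ)) ψ.subs))
    have h₄ := h₁.trans (subsBound_mono
      (Set.subset_insert (Sum.inl (StateFormula.probPos ψ)) ψ.subs))
    have h₅ := h₁.trans (subsBound_mono
      (Set.subset_insert (Sum.inl (StateFormula.probOne ψ)) ψ.subs))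
    simp only [StateFormula.relativize, StateFormula.subs, PathFormula.subs, nonBlank,
      recurNonBlank, Set.insert_subset_iff, Set.union_subset_iff, Set.singleton_subset_iff,
      h₂, h₃, h₄, h₅]
    simp [subsBound, ownSubs, sharedSubs, StateFormula.relativize, nonBlank, recurNonBlank]

theorem PathFormula.subs_relativize_subset {A : Type} :
    ∀ ψ : PathFormula A, ψ.relativize.subs ⊆ subsBound ψ.subs
  | .state φ => by
    have h₁ := (StateFormula.subs_relativize_subset φ).trans (subsBound_mono
      (Set.subset_insert (Sum.inr (PathFormula.state φ)) φ.subs))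
    simp only [PathFormula.relativize, PathFormula.subs, Set.insert_subset_iff, h₁]
    simp [subsBound, ownSubs, PathFormula.relativize]
  | .and ψ₁ ψ₂ | .or ψ₁ ψ₂ => by
    have h₁ := PathFormula.subs_relativize_subset ψ₁
    have h₂ := PathFormula.subs_relativize_subset ψ₂
    simp only [PathFormula.relativize, PathFormula.subs, Set.insert_subset_iff,
      Set.union_subset_iff]
    refine ⟨Or.inr ⟨_, Set.mem_insert _ _, by simp [ownSubs, PathFormula.relativize]⟩,
      h₁.trans (subsBound_mono ?_), h₂.trans (subsBound_mono ?_)⟩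
    · exact fun x hx => Or.inr (Or.inl hx)
    · exact fun x hx => Or.inr (Or.inr hx)
  | .untl ψ₁ ψ₂ => by
    have h₁ := (PathFormula.subs_relativize_subset ψ₁).trans (subsBound_mono
        (t := (ψ₁.untl ψ₂).subs)
      fun x hx => Or.inr (Or.inl hx))
    have h₂ := (PathFormula.subs_relativize_subset ψ₂).trans (subsBound_mono
        (t := (ψ₁.untl ψ₂).subs)
      fun x hx => Or.inr (Or.inr hx))
    simp only [PathFormula.subs] at h₁ h₂
    simp only [PathFormula.relativize, PathFormula.subs, StateFormula.subs, nonBlank, blankPath,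
      Set.insert_subset_iff, Set.union_subset_iff, Set.singleton_subset_iff, h₁, h₂]
    simp [subsBound, ownSubs, sharedSubs, PathFormula.relativize, nonBlank, blankPath]
  | .not ψ | .next ψ | .always ψ => by
    have h₁ := PathFormula.subs_relativize_subset ψ
    have h₂ := h₁.trans (subsBound_mono
      (Set.subset_insert (Sum.inr (PathFormula.not ψ)) ψ.subs))
    have h₃ := h₁.trans (subsBound_mono
      (Set.subset_insert (Sum.inr (PathFormula.next ψ)) ψ.subs))
    have h₄ := h₁.trans (subsBound_mono
      (Set.subset_insert (Sum.inr (PathFormula.always ψ)) ψ.subs))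
    simp only [PathFormula.relativize, PathFormula.subs, StateFormula.subs, nonBlank, blankPath,
      Set.insert_subset_iff, Set.union_subset_iff, Set.singleton_subset_iff, h₂, h₃, h₄]
    simp [subsBound, ownSubs, sharedSubs, PathFormula.relativize, nonBlank, blankPath]

end

theorem length_ownSubs_le {A : Type} (x : StateFormula A ⊕ PathFormula A) :
    (ownSubs x).length ≤ 3 := by
  rcases x with φ | ψ
  · cases φ <;> simp [ownSubs]
  · cases ψ <;> simp [ownSubs]

theorem ncard_subsBound_le {A : Type} {s : Set (StateFormula A ⊕ PathFormula A)}
    (hs : s.Finite) : (subsBound s).Finite ∧ (subsBound s).ncard ≤ 9 + 3 * s.ncard := by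
  classical
  lift s to Finset (StateFormula A ⊕ PathFormula A) using hs
  have h : subsBound (s : Set (StateFormula A ⊕ PathFormula A)) =
      ((sharedSubs.toFinset ∪ s.biUnion fun x => (ownSubs x).toFinset : Finset _) : Set _) := by
    ext y
    simp [subsBound]
  rw [h, Set.ncard_coe_finset, Set.ncard_coe_finset]
  refine ⟨Finset.finite_toSet _, (Finset.card_union_le _ _).trans (add_le_add ?_ ?_)⟩
  · exact (List.toFinset_card_le _).trans (by simp [sharedSubs])
  · rw [mul_comm]
    exact Finset.card_biUnion_le_card_mul _ _ _ fun x _ =>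
      (List.toFinset_card_le _).trans (length_ownSubs_le x)

theorem StateFormula.dagSize_pos {A : Type} (φ : StateFormula A) : 0 < φ.dagSize := by
  rw [StateFormula.dagSize, Set.ncard_pos φ.finite_subs]
  cases φ <;> simp [StateFormula.subs]

theorem StateFormula.dagSize_toTree_le {A : Type} (φ : StateFormula A) :
    φ.toTree.dagSize ≤ 20 * φ.dagSize := by
  obtain ⟨hfin, hcard⟩ := ncard_subsBound_le φ.finite_subs
  have hsub : φ.toTree.subs ⊆
      insert (.inl φ.toTree) (insert (.inl (.probOne recurNonBlank)) (subsBound φ.subs)) := by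
    have h := φ.subs_relativize_subset.trans
      ((Set.subset_insert (.inl (.probOne recurNonBlank)) _).trans
        (Set.subset_insert (.inl φ.toTree) _))
    simp only [recurNonBlank, nonBlank, StateFormula.toTree] at h
    simp only [StateFormula.toTree, StateFormula.subs, PathFormula.subs, recurNonBlank, nonBlank,
      Set.insert_subset_iff, Set.union_subset_iff, Set.singleton_subset_iff, h]
    simp [subsBound, sharedSubs, nonBlank, recurNonBlank]
  have h₁ := Set.ncard_le_ncard hsub ((hfin.insert _).insert _)
  have h₂ := Set.ncard_insert_le (.inl φ.toTree)
    (insert (.inl (.probOne recurNonBlank)) (subsBound φ.subs))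
  have h₃ := Set.ncard_insert_le (.inl (.probOne recurNonBlank)) (subsBound φ.subs)
  have h₄ := φ.dagSize_pos
  simp only [StateFormula.dagSize] at h₄ ⊢
  omega

/-! ### The translation on words -/

/-- The word substituted for a symbol. -/
def Symb.subst {A : Type} : Symb A → List (Symb (Option A))
  | .top => [.sNot, .letter none]
  | .bot => [.bot]
  | .letter a => [.letter (some a)]
  | .sAnd => [.sAnd]
  | .sOr => [.sOr]
  | .sNot => [.sAnd, .sNot, .letter none, .sNot]
  | .ex => [.sAnd, .sNot, .letter none, .ex, .pAnd, .always, .untl, .top, .sNot, .letter none]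
  | .all => [.sAnd, .sNot, .letter none, .all, .pOr, .pNot, .always, .untl, .top, .sNot,
      .letter none]
  | .probPos => [.sAnd, .sNot, .letter none, .probPos]
  | .probOne => [.sAnd, .sNot, .letter none, .probOne]
  | .pNot => [.pAnd, .sNot, .letter none, .pNot]
  | .pAnd => [.pAnd]
  | .pOr => [.pOr]
  | .next => [.pAnd, .sNot, .letter none, .next, .untl, .letter none]
  | .untl => [.pAnd, .sNot, .letter none, .untl, .pOr, .letter none]
  | .always => [.pAnd, .sNot, .letter none, .always, .pOr, .letter none]

mutual

theorem StateFormula.word_relativize {A : Type} :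
    ∀ φ : StateFormula A, φ.relativize.word = φ.word.flatMap Symb.subst
  | .top | .bot | .letter _ => rfl
  | .and φ₁ φ₂ | .or φ₁ φ₂ => by
    simp [StateFormula.relativize, StateFormula.word, Symb.subst, StateFormula.word_relativize φ₁,
      StateFormula.word_relativize φ₂]
  | .not φ => by
    simp [StateFormula.relativize, StateFormula.word, Symb.subst, StateFormula.word_relativize φ,
        nonBlank]
  | .ex ψ | .all ψ | .probPos ψ | .probOne ψ => by
    simp [StateFormula.relativize, StateFormula.word, PathFormula.word, Symb.subst,
      PathFormula.word_relativize ψ, nonBlank, recurNonBlank]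

theorem PathFormula.word_relativize {A : Type} :
    ∀ ψ : PathFormula A, ψ.relativize.word = ψ.word.flatMap Symb.subst
  | .state φ => StateFormula.word_relativize φ
  | .and ψ₁ ψ₂ | .or ψ₁ ψ₂ | .untl ψ₁ ψ₂ => by
    simp [PathFormula.relativize, PathFormula.word, StateFormula.word, Symb.subst,
      PathFormula.word_relativize ψ₁, PathFormula.word_relativize ψ₂, nonBlank, blankPath]
  | .not ψ | .next ψ | .always ψ => by
    simp [PathFormula.relativize, PathFormula.word, StateFormula.word, Symb.subst,
      PathFormula.word_relativize ψ, nonBlank, blankPath]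

end

theorem StateFormula.word_toTree {A : Type} (φ : StateFormula A) :
    φ.toTree.word = [.sAnd, .probOne, .always, .untl, .top, .sNot, .letter none] ++
      φ.word.flatMap Symb.subst := by
  simp [StateFormula.toTree, StateFormula.word, PathFormula.word, recurNonBlank, nonBlank,
    word_relativize]

/-! ### A linear-time machine for letterwise substitutions -/

namespace SubstMachine

variable {Γ₀ Γ₁ : Type}

/-- Alphabets of the input stack, the auxiliary stack and the output stack. -/
def StackAlphabet (Γ₀ Γ₁ : Type) : Fin 3 → Type
  | 0 => Γ₀
  | 1 => Γ₀
  | 2 => Γ₁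

/-- The statements of the machine; the state holds the symbol read last. -/
abbrev Stmt (Γ₀ Γ₁ : Type) : Type :=
  Turing.TM2.Stmt (StackAlphabet Γ₀ Γ₁) Bool (Option Γ₀)

/-- The contents of the three stacks. -/
def stackContents (x y : List Γ₀) (z : List Γ₁) : ∀ k, List (StackAlphabet Γ₀ Γ₁ k)
  | 0 => x
  | 1 => y
  | 2 => z

theorem update_stackContents_one (x y y' : List Γ₀) (z : List Γ₁) :
    Function.update (stackContents x y z) 1 y' = stackContents x y' z := by
  funext k; fin_cases k <;> rfl

theorem update_stackContents_two (x y : List Γ₀) (z z' : List Γ₁) :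
    Function.update (stackContents x y z) 2 z' = stackContents x y z' := by
  funext k; fin_cases k <;> rfl

/-- Write the first `j` symbols of the word `h a` on the output stack, `a` being the symbol read
last. -/
def emit [Inhabited Γ₀] [Inhabited Γ₁] (h : Γ₀ → List Γ₁) (q : Stmt Γ₀ Γ₁) :
    ℕ → Stmt Γ₀ Γ₁
  | 0 => q
  | j + 1 => .branch (fun v => decide (j < (h (v.getD default)).length))
      (.push 2 (fun v => (h (v.getD default)).getD j default) (emit h q j)) (emit h q j)

/-- Write the word `l` on the output stack. -/
def write (q : Stmt Γ₀ Γ₁) : List Γ₁ → Stmt Γ₀ Γ₁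
  | [] => q
  | b :: l => write (.push 2 (fun _ => b) q) l

theorem stepAux_emit [Inhabited Γ₀] [Inhabited Γ₁] (h : Γ₀ → List Γ₁) (q : Stmt Γ₀ Γ₁) (j : ℕ)
    (a : Γ₀) (x y : List Γ₀) (z : List Γ₁) :
    Turing.TM2.stepAux (emit h q j) (some a) (stackContents x y z) =
      Turing.TM2.stepAux q (some a) (stackContents x y ((h a).take j ++ z)) := by
  induction j generalizing z with
  | zero => simp [emit]
  | succ j ih =>
    by_cases hj : j < (h a).length
    · simp only [emit, Turing.TM2.stepAux, Option.getD_some, hj, decide_true, cond_true]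
      refine (congrArg (Turing.TM2.stepAux (emit h q j) (some a))
        (update_stackContents_two x y z _)).trans ((ih _).trans ?_)
      have hz : (h a).take j ++ ((h a).getD j default :: z) = (h a).take (j + 1) ++ z := by
        rw [List.take_succ_eq_append_getElem hj, List.getD_eq_getElem _ _ hj, List.append_assoc]
        rfl
      exact congrArg (fun z => Turing.TM2.stepAux q (some a) (stackContents x y z)) hz
    · simp only [emit, Turing.TM2.stepAux, Option.getD_some, hj, decide_false, cond_false]
      rw [ih, List.take_of_length_le (by omega), List.take_of_length_le (by omega)]

theorem stepAux_write (q : Stmt Γ₀ Γ₁) (l : List Γ₁) (v : Option Γ₀) (x y : List Γ₀)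
    (z : List Γ₁) :
    Turing.TM2.stepAux (write q l) v (stackContents x y z) =
      Turing.TM2.stepAux q v (stackContents x y (l ++ z)) := by
  induction l generalizing q with
  | nil => rfl
  | cons b l ih =>
    rw [write, ih]
    exact congrArg (Turing.TM2.stepAux q v) (update_stackContents_two x y _ _)

/-- The program: at `false` the input is reversed on the auxiliary stack, at `true` the words
substituted for its symbols are written on the output stack, followed by `pre`. -/
def program [Inhabited Γ₀] [Inhabited Γ₁] (h : Γ₀ → List Γ₁) (pre : List Γ₁) (N : ℕ) :
    Bool → Stmt Γ₀ Γ₁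
  | false => .pop 0 (fun _ o => o) (.branch Option.isSome
      (.push 1 (fun v => v.getD default) (.goto fun _ => false)) (.goto fun _ => true))
  | true => .pop 1 (fun _ o => o) (.branch Option.isSome
      (emit h (.goto fun _ => true) N) (write .halt pre))

section Run

variable [Inhabited Γ₀] [Inhabited Γ₁] (h : Γ₀ → List Γ₁) (pre : List Γ₁) (N : ℕ)

/-- A configuration of the machine. -/
def config (l : Option Bool) (v : Option Γ₀) (x y : List Γ₀) (z : List Γ₁) :
    Turing.TM2.Cfg (StackAlphabet Γ₀ Γ₁) Bool (Option Γ₀) :=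
  ⟨l, v, stackContents x y z⟩

theorem step_reverse_cons (v : Option Γ₀) (a : Γ₀) (x y : List Γ₀) (z : List Γ₁) :
    Turing.TM2.step (program h pre N) (config (some false) v (a :: x) y z) =
      some (config (some false) (some a) x (a :: y) z) := by
  refine congrArg (fun S => some (⟨some false, some a, S⟩ :
    Turing.TM2.Cfg (StackAlphabet Γ₀ Γ₁) Bool (Option Γ₀))) ?_
  funext k; fin_cases k <;> rfl

theorem step_reverse_nil (v : Option Γ₀) (y : List Γ₀) (z : List Γ₁) :
    Turing.TM2.step (program h pre N) (config (some false) v [] y z) =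
      some (config (some true) none [] y z) := by
  refine congrArg (fun S => some (⟨some true, none, S⟩ :
    Turing.TM2.Cfg (StackAlphabet Γ₀ Γ₁) Bool (Option Γ₀))) ?_
  funext k; fin_cases k <;> rfl

theorem step_emit_cons (hN : ∀ a, (h a).length ≤ N) (v : Option Γ₀) (a : Γ₀) (x y : List Γ₀)
    (z : List Γ₁) :
    Turing.TM2.step (program h pre N) (config (some true) v x (a :: y) z) =
      some (config (some true) (some a) x y (h a ++ z)) := by
  refine congrArg some (((congrArg (Turing.TM2.stepAux (emit h (.goto fun _ => true) N) (some a))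
    (update_stackContents_one x (a :: y) y z)).trans (stepAux_emit _ _ _ _ _ _ _)).trans ?_)
  rw [List.take_of_length_le (hN a)]
  rfl

theorem step_emit_nil (v : Option Γ₀) (x : List Γ₀) (z : List Γ₁) :
    Turing.TM2.step (program h pre N) (config (some true) v x [] z) =
      some (config none none x [] (pre ++ z)) := by
  exact congrArg some ((congrArg (Turing.TM2.stepAux (write .halt pre) none)
    (update_stackContents_one x [] [] z)).trans (stepAux_write _ _ _ _ _ _))

theorem run_reverse (v : Option Γ₀) (x y : List Γ₀) (z : List Γ₁) :
    (flip bind (Turing.TM2.step (program h pre N)))^[x.length + 1]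
        (some (config (some false) v x y z)) =
      some (config (some true) none [] (x.reverse ++ y) z) := by
  induction x generalizing v y with
  | nil => exact step_reverse_nil h pre N v y z
  | cons a x ih =>
    rw [List.length_cons, Function.iterate_succ_apply]
    refine (congrArg _ (step_reverse_cons h pre N v a x y z)).trans ?_
    rw [ih]
    simp

theorem run_emit (hN : ∀ a, (h a).length ≤ N) (v : Option Γ₀) (x y : List Γ₀) (z : List Γ₁) :
    (flip bind (Turing.TM2.step (program h pre N)))^[y.length + 1]
        (some (config (some true) v x y z)) =
      some (config none none x [] (pre ++ (y.reverse.flatMap h ++ z))) := by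
  induction y generalizing v z with
  | nil => exact step_emit_nil h pre N v x z
  | cons a y ih =>
    rw [List.length_cons, Function.iterate_succ_apply]
    refine (congrArg _ (step_emit_cons h pre N hN v a x y z)).trans ?_
    rw [ih]
    simp

variable [Fintype Γ₀]

/-- The machine computing `w ↦ pre ++ w.flatMap h`. -/
def machine : Turing.FinTM2 where
  K := Fin 3
  k₀ := 0
  k₁ := 2
  Γ := StackAlphabet Γ₀ Γ₁
  Λ := Bool
  main := false
  σ := Option Γ₀
  initialState := none
  Γk₀Fin := inferInstanceAs (Fintype Γ₀)
  m := program h pre N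

theorem initList_machine (w : List Γ₀) :
    Turing.initList (machine h pre N) w = config (some false) none w [] [] := by
  refine congrArg (fun S => (⟨some false, none, S⟩ :
    Turing.TM2.Cfg (StackAlphabet Γ₀ Γ₁) Bool (Option Γ₀))) ?_
  funext k
  rcases k with ⟨_ | _ | _ | k, hk⟩
  · rfl
  · rfl
  · rfl
  · omega

theorem haltList_machine (w : List Γ₁) :
    Turing.haltList (machine h pre N) w = config none none [] [] w := by
  refine congrArg (fun S => (⟨none, none, S⟩ :
    Turing.TM2.Cfg (StackAlphabet Γ₀ Γ₁) Bool (Option Γ₀))) ?_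
  funext k
  rcases k with ⟨_ | _ | _ | k, hk⟩
  · rfl
  · rfl
  · rfl
  · omega

/-- The machine maps `w` to `pre ++ w.flatMap h` in `2 * (|w| + 1)` steps. -/
def outputsInTime (hN : ∀ a, (h a).length ≤ N) (w : List Γ₀) :
    Turing.TM2OutputsInTime (machine h pre N) w (some (pre ++ w.flatMap h))
      (2 * (w.length + 1)) where
  steps := (w.length + 1) + (w.length + 1)
  evals_in_steps := by
    have h₁ := run_reverse h pre N none w [] []
    have h₂ := run_emit h pre N hN none [] (w.reverse ++ []) []
    rw [List.append_nil, List.length_reverse, List.reverse_reverse, List.append_nil] at h₂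
    rw [Function.iterate_add_apply, initList_machine]
    refine (congrArg _ h₁).trans ?_
    rw [List.append_nil]
    exact h₂.trans (congrArg some (haltList_machine h pre N _).symm)
  steps_le_m := by omega

/-- Transport of `TM2OutputsInTime` along equalities of words. -/
def outputsInTimeCongr {w w' : List Γ₀} {u u' : List Γ₁} {t : ℕ} (hw : w' = w) (hu : u' = u)
    (H : Turing.TM2OutputsInTime (machine h pre N) w (some u) t) :
    Turing.TM2OutputsInTime (machine h pre N) w' (some u') t := by
  subst hw hu
  exact H

end Run

end SubstMachine

theorem Symb.finite (A : Type) [Finite A] : Finite (Symb A) := by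
  let e : Fin 15 ⊕ A → Symb A := Sum.elim
    ![.top, .bot, .sAnd, .sOr, .sNot, .ex, .all, .probPos, .probOne, .pNot, .pAnd, .pOr, .next,
      .untl, .always] .letter
  refine Finite.of_surjective e fun x => ?_
  cases x with
  | letter a => exact ⟨.inr a, rfl⟩
  | top => exact ⟨.inl 0, rfl⟩
  | bot => exact ⟨.inl 1, rfl⟩
  | sAnd => exact ⟨.inl 2, rfl⟩
  | sOr => exact ⟨.inl 3, rfl⟩
  | sNot => exact ⟨.inl 4, rfl⟩
  | ex => exact ⟨.inl 5, rfl⟩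
  | all => exact ⟨.inl 6, rfl⟩
  | probPos => exact ⟨.inl 7, rfl⟩
  | probOne => exact ⟨.inl 8, rfl⟩
  | pNot => exact ⟨.inl 9, rfl⟩
  | pAnd => exact ⟨.inl 10, rfl⟩
  | pOr => exact ⟨.inl 11, rfl⟩
  | next => exact ⟨.inl 12, rfl⟩
  | untl => exact ⟨.inl 13, rfl⟩
  | always => exact ⟨.inl 14, rfl⟩

instance (A : Type) : Inhabited (Symb A) := ⟨.top⟩

theorem Symb.length_subst_le {A : Type} (x : Symb A) : x.subst.length ≤ 11 := by
  cases x <;> simp [Symb.subst]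

theorem computableInLinearTime_toTree (A : Type) [Finite A] :
    ComputableInLinearTime (StateFormula.toTree (A := A)) 20 := by
  have := Symb.finite A
  let : Fintype (Symb A) := Fintype.ofFinite _
  let pre : List (Symb (Option A)) :=
    [.sAnd, .probOne, .always, .untl, .top, .sNot, .letter none]
  refine ⟨{ tm := SubstMachine.machine Symb.subst pre 11
            inputAlphabet := Equiv.refl (Symb A)
            outputAlphabet := Equiv.refl (Symb (Option A))
            time := fun n => 2 * (n + 1)
            outputsFun := fun φ => ?_ }, fun n => ?_⟩
  · have h := SubstMachine.outputsInTime Symb.subst pre 11 Symb.length_subst_le φ.word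
    rw [← StateFormula.word_toTree] at h
    exact SubstMachine.outputsInTimeCongr Symb.subst pre 11 (List.map_id _) (List.map_id _) h
  · change 2 * (n + 1) ≤ 20 * (n + 1)
    omega

/-! ### Relativized formulas fail at blank nodes -/

mutual

theorem StateFormula.not_sat_relativize {N A : Type} (T : MarkovChain N (Option A)) {n : N}
    (h : T.label n = none) : ∀ φ : StateFormula A, ¬ φ.relativize.Sat T n
  | .top => fun H => H h
  | .bot => fun H => H
  | .letter a => fun H => by
    rw [StateFormula.relativize, StateFormula.Sat, h] at H
    cases H
  | .and φ₁ _ => fun H => StateFormula.not_sat_relativize T h φ₁ H.1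
  | .or φ₁ φ₂ => fun H => H.elim (StateFormula.not_sat_relativize T h φ₁)
      (StateFormula.not_sat_relativize T h φ₂)
  | .not _ => fun H => H.1 h
  | .ex _ => fun H => H.1 h
  | .all _ => fun H => H.1 h
  | .probPos _ => fun H => H.1 h
  | .probOne _ => fun H => H.1 h

theorem PathFormula.not_sat_relativize {N A : Type} (T : MarkovChain N (Option A)) {w : ℕ → N}
    (h : T.label (w 0) = none) : ∀ ψ : PathFormula A, ¬ ψ.relativize.Sat T w
  | .state φ => StateFormula.not_sat_relativize T h φ
  | .not _ => fun H => H.1 h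
  | .and ψ₁ _ => fun H => PathFormula.not_sat_relativize T h ψ₁ H.1
  | .or ψ₁ ψ₂ => fun H => H.elim (PathFormula.not_sat_relativize T h ψ₁)
      (PathFormula.not_sat_relativize T h ψ₂)
  | .next _ => fun H => H.1 h
  | .untl _ _ => fun H => H.1 h
  | .always _ => fun H => H.1 h

end

theorem sat_recurNonBlank {N A : Type} (T : MarkovChain N (Option A)) (w : ℕ → N) :
    (recurNonBlank (A := A)).Sat T w ↔ ∀ k, ∃ n, T.label (w (k + n)) ≠ none := by
  simp [recurNonBlank, nonBlank, PathFormula.Sat, StateFormula.Sat]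

/-! ### Subpaths of non-blank nodes -/

/-- `v` is the sequence of the states that `π` assigns to the non-blank nodes of `w`; the latter
are found at the positions enumerated by `g`, the first being `0`. -/
structure Subpath {N S : Type} (π : N → Option S) (w : ℕ → N) (v : ℕ → S) (g : ℕ → ℕ) :
    Prop where
  strictMono : StrictMono g
  zero : g 0 = 0
  visit : ∀ i, π (w (g i)) = some (v i)
  skip : ∀ k, k ∉ Set.range g → π (w k) = none

namespace Subpath

variable {N S : Type} {π : N → Option S} {w : ℕ → N} {v : ℕ → S} {g : ℕ → ℕ}

theorem shift (h : Subpath π w v g) (j : ℕ) :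
    Subpath π (fun i => w (g j + i)) (fun i => v (j + i)) (fun i => g (j + i) - g j) := by
  have hle : ∀ i, g j ≤ g (j + i) := fun i => h.strictMono.monotone (Nat.le_add_right _ _)
  refine ⟨fun a b hab => ?_, by simp, fun i => ?_, fun k hk => h.skip _ ?_⟩
  · have := h.strictMono (show j + a < j + b by omega)
    have := hle a
    change g (j + a) - g j < g (j + b) - g j
    omega
  · rw [Nat.add_sub_cancel' (hle i)]
    exact h.visit _
  · rintro ⟨i, hi⟩
    have hji : j ≤ i := h.strictMono.le_iff_le.1 (by omega)
    refine hk ⟨i - j, ?_⟩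
    change g (j + (i - j)) - g j = k
    rw [Nat.add_sub_cancel' hji]
    omega

theorem mem_range (h : Subpath π w v g) {k : ℕ} (hk : π (w k) ≠ none) : ∃ i, g i = k := by
  by_contra hc
  exact hk (h.skip k hc)

theorem recurrent (h : Subpath π w v g) (k : ℕ) : ∃ n, π (w (k + n)) ≠ none := by
  refine ⟨g k - k, ?_⟩
  have hle : k ≤ g k := h.strictMono.id_le k
  rw [Nat.add_sub_cancel' hle, h.visit]
  simp

end Subpath

/-- The states assigned to the non-blank nodes of `w`, in their order, where `s₀` is a dummy. -/
noncomputable def extract {N S : Type} (π : N → Option S) (s₀ : S) (w : ℕ → N) (i : ℕ) : S :=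
  (π (w (Nat.nth (fun k => π (w k) ≠ none) i))).getD s₀

theorem subpath_extract {N S : Type} (π : N → Option S) (s₀ : S) {w : ℕ → N}
    (h0 : π (w 0) ≠ none) (h : ∀ k, ∃ n, π (w (k + n)) ≠ none) :
    Subpath π w (extract π s₀ w) (Nat.nth fun k => π (w k) ≠ none) := by
  have hinf : {k | π (w k) ≠ none}.Infinite := by
    refine Set.infinite_of_forall_exists_gt fun k => ?_
    obtain ⟨n, hn⟩ := h (k + 1)
    exact ⟨k + 1 + n, hn, by omega⟩
  refine ⟨Nat.nth_strictMono hinf, Nat.nth_zero_of_zero h0, fun i => ?_, fun k hk => ?_⟩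
  · obtain ⟨s, hs⟩ := Option.ne_none_iff_exists'.1 (Nat.nth_mem_of_infinite hinf i)
    rw [extract, hs]
    rfl
  · rw [Nat.range_nth_of_infinite hinf] at hk
    simpa using hk

/-! ### Simulations -/

/-- The chain `T` simulates `M`: after deletion of the blank nodes, its paths and their
probabilities are those of `M`. -/
structure Simulates {N S A : Type} (T : MarkovChain N (Option A)) (M : MarkovChain S A)
    (π : N → Option S) : Prop where
  label : ∀ n, T.label n = (π n).map M.label
  proj : ∀ {n s w v g}, π n = some s → T.IsPath n w → Subpath π w v g → M.IsPath s v
  lift : ∀ {n s v}, π n = some s → M.IsPath s v → ∃ w g, T.IsPath n w ∧ Subpath π w v g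
  prob : ∀ {n s D E}, π n = some s → (MeasurableSet[@MeasurableSpace.pi _ _ fun _ => ⊤] E) →
    (∀ w v g, T.IsPath n w → Subpath π w v g → (w ∈ D ↔ v ∈ E)) → T.prob n D = M.prob s E

theorem Simulates.label_eq_none {N S A : Type} {T : MarkovChain N (Option A)}
    {M : MarkovChain S A} {π : N → Option S} (h : Simulates T M π) (n : N) :
    T.label n = none ↔ π n = none := by
  rw [h.label, Option.map_eq_none_iff]

section Measurable

variable {S A : Type} (M : MarkovChain S A)

theorem measurableSet_sat [MeasurableSpace S] [DiscreteMeasurableSpace S] :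
    ∀ ψ : PathFormula A, MeasurableSet {w | ψ.Sat M w}
  | .state φ => by
    have : MeasurableSet ((fun w : ℕ → S => w 0) ⁻¹' {s | φ.Sat M s}) :=
      measurable_pi_apply 0 (MeasurableSet.of_discrete)
    exact this
  | .not ψ => (measurableSet_sat ψ).compl
  | .and ψ₁ ψ₂ => (measurableSet_sat ψ₁).inter (measurableSet_sat ψ₂)
  | .or ψ₁ ψ₂ => (measurableSet_sat ψ₁).union (measurableSet_sat ψ₂)
  | .next ψ => (measurable_pi_lambda (fun (w : ℕ → S) i => w (1 + i))
      fun i => measurable_pi_apply _) (measurableSet_sat ψ)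
  | .untl ψ₁ ψ₂ => by
    have hm : ∀ k, Measurable fun (w : ℕ → S) i => w (k + i) := fun k =>
      measurable_pi_lambda _ fun i => measurable_pi_apply _
    simp only [PathFormula.Sat, Set.ofPred_exists, Set.ofPred_and, Set.ofPred_forall]
    exact MeasurableSet.iUnion fun n => (MeasurableSet.iInter fun k => MeasurableSet.iInter
      fun _ => hm k (measurableSet_sat ψ₁)).inter (hm n (measurableSet_sat ψ₂))
  | .always ψ => by
    have hm : ∀ k, Measurable fun (w : ℕ → S) i => w (k + i) := fun k =>
      measurable_pi_lambda _ fun i => measurable_pi_apply _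
    simp only [PathFormula.Sat, Set.ofPred_forall]
    exact MeasurableSet.iInter fun k => hm k (measurableSet_sat ψ)

theorem measurableSet_isPath [Countable S] [MeasurableSpace S] [DiscreteMeasurableSpace S] (s : S) :
    MeasurableSet {w | M.IsPath s w} := by
  simp only [MarkovChain.IsPath, Set.ofPred_and, Set.ofPred_forall]
  have h0 : MeasurableSet ((fun w : ℕ → S => w 0) ⁻¹' {s}) :=
    measurable_pi_apply 0 (MeasurableSet.singleton s)
  refine MeasurableSet.inter h0 (MeasurableSet.iInter fun n => ?_)
  have hm : Measurable fun w : ℕ → S => (w n, w (n + 1)) :=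
    (measurable_pi_apply n).prodMk (measurable_pi_apply (n + 1))
  exact hm (MeasurableSet.of_discrete (s := {x : S × S | 0 < M.p x.1 x.2}))

end Measurable

mutual

theorem Simulates.sat_iff {N S A : Type} [Countable S] {T : MarkovChain N (Option A)}
    {M : MarkovChain S A} {π : N → Option S} (h : Simulates T M π) :
    ∀ (φ : StateFormula A) {n : N} {s : S}, π n = some s →
      (φ.relativize.Sat T n ↔ φ.Sat M s)
  | .top, n, s, hs => by
    have : T.label n ≠ none := by simp [h.label, hs]
    simpa [StateFormula.relativize, StateFormula.Sat, nonBlank] using this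
  | .bot, n, s, hs => Iff.rfl
  | .letter a, n, s, hs => by simp [StateFormula.relativize, StateFormula.Sat, h.label, hs]
  | .and φ₁ φ₂, n, s, hs => and_congr (Simulates.sat_iff h φ₁ hs) (Simulates.sat_iff h φ₂ hs)
  | .or φ₁ φ₂, n, s, hs => or_congr (Simulates.sat_iff h φ₁ hs) (Simulates.sat_iff h φ₂ hs)
  | .not φ, n, s, hs => by
    have : T.label n ≠ none := by simp [h.label, hs]
    exact (and_iff_right this).trans (not_congr (Simulates.sat_iff h φ hs))
  | .ex ψ, n, s, hs => by
    have : T.label n ≠ none := by simp [h.label, hs]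
    refine (and_iff_right this).trans ⟨?_, ?_⟩
    · rintro ⟨w, hw, hrec, hψ⟩
      rw [sat_recurNonBlank] at hrec
      simp only [ne_eq, h.label_eq_none] at hrec
      have hsub := subpath_extract π s (by rw [hw.1, hs]; simp) hrec
      exact ⟨_, h.proj hs hw hsub, (Simulates.path_sat_iff h ψ hsub).1 hψ⟩
    · rintro ⟨v, hv, hψ⟩
      obtain ⟨w, g, hw, hsub⟩ := h.lift hs hv
      refine ⟨w, hw, (sat_recurNonBlank T w).2 ?_, (Simulates.path_sat_iff h ψ hsub).2 hψ⟩
      simpa only [ne_eq, h.label_eq_none] using hsub.recurrent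
  | .all ψ, n, s, hs => by
    have : T.label n ≠ none := by simp [h.label, hs]
    refine (and_iff_right this).trans ⟨fun H v hv => ?_, fun H w hw => ?_⟩
    · obtain ⟨w, g, hw, hsub⟩ := h.lift hs hv
      refine (Simulates.path_sat_iff h ψ hsub).1 ((H w hw).resolve_left fun hn => hn ?_)
      refine (sat_recurNonBlank T w).2 ?_
      simpa only [ne_eq, h.label_eq_none] using hsub.recurrent
    · refine or_iff_not_imp_left.2 fun hrec => ?_
      have hrec := (sat_recurNonBlank T w).1 (not_not.1 hrec)
      simp only [ne_eq, h.label_eq_none] at hrec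
      have hsub := subpath_extract π s (by rw [hw.1, hs]; simp) hrec
      exact (Simulates.path_sat_iff h ψ hsub).2 (H _ (h.proj hs hw hsub))
  | .probPos ψ, n, s, hs => by
    have : T.label n ≠ none := by simp [h.label, hs]
    refine (and_iff_right this).trans (iff_of_eq (congrArg (0 < ·) (h.prob hs ?_ ?_)))
    · let : MeasurableSpace S := ⊤
      have : DiscreteMeasurableSpace S := ⟨fun _ => trivial⟩
      exact (measurableSet_isPath M s).inter (measurableSet_sat M ψ)
    · exact fun w v g hw hsub => ⟨fun H => ⟨h.proj hs hw hsub,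
        (Simulates.path_sat_iff h ψ hsub).1 H.2⟩, fun H => ⟨hw,
        (Simulates.path_sat_iff h ψ hsub).2 H.2⟩⟩
  | .probOne ψ, n, s, hs => by
    have : T.label n ≠ none := by simp [h.label, hs]
    refine (and_iff_right this).trans (iff_of_eq (congrArg (· = 1) (h.prob hs ?_ ?_)))
    · let : MeasurableSpace S := ⊤
      have : DiscreteMeasurableSpace S := ⟨fun _ => trivial⟩
      exact (measurableSet_isPath M s).inter (measurableSet_sat M ψ)
    · exact fun w v g hw hsub => ⟨fun H => ⟨h.proj hs hw hsub,
        (Simulates.path_sat_iff h ψ hsub).1 H.2⟩, fun H => ⟨hw,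
        (Simulates.path_sat_iff h ψ hsub).2 H.2⟩⟩

theorem Simulates.path_sat_iff {N S A : Type} [Countable S] {T : MarkovChain N (Option A)}
    {M : MarkovChain S A} {π : N → Option S} (h : Simulates T M π) :
    ∀ (ψ : PathFormula A) {w : ℕ → N} {v : ℕ → S} {g : ℕ → ℕ}, Subpath π w v g →
      (ψ.relativize.Sat T w ↔ ψ.Sat M v)
  | .state φ, w, v, g, hsub => Simulates.sat_iff h φ (by
      have := hsub.visit 0
      rwa [hsub.zero] at this)
  | .and ψ₁ ψ₂, w, v, g, hsub =>
    and_congr (Simulates.path_sat_iff h ψ₁ hsub) (Simulates.path_sat_iff h ψ₂ hsub)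
  | .or ψ₁ ψ₂, w, v, g, hsub =>
    or_congr (Simulates.path_sat_iff h ψ₁ hsub) (Simulates.path_sat_iff h ψ₂ hsub)
  | .not ψ, w, v, g, hsub => by
    have hv := hsub.visit 0
    rw [hsub.zero] at hv
    have : T.label (w 0) ≠ none := by simp [h.label, hv]
    exact (and_iff_right this).trans (not_congr (Simulates.path_sat_iff h ψ hsub))
  | .next ψ, w, v, g, hsub => by
    have hv := hsub.visit 0
    rw [hsub.zero] at hv
    have : T.label (w 0) ≠ none := by simp [h.label, hv]
    have ih := Simulates.path_sat_iff h ψ (hsub.shift 1)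
    have hg1 : 0 < g 1 := hsub.zero ▸ hsub.strictMono Nat.zero_lt_one
    refine (and_iff_right this).trans ⟨?_, fun H => ?_⟩
    · rintro ⟨n, hn, hψ⟩
      have hblank : T.label (w (1 + n)) ≠ none := fun hb =>
        PathFormula.not_sat_relativize T (w := fun i => w (1 + (n + i))) hb ψ hψ
      rw [ne_eq, h.label_eq_none] at hblank
      obtain ⟨i, hi⟩ := hsub.mem_range hblank
      have hi1 : i = 1 := by
        by_contra hne
        rcases Nat.lt_or_ge 1 i with hlt | hge
        · have hlt' := hsub.strictMono hlt
          have hb : T.label (w (1 + (g 1 - 1 + 0))) = none := hn (g 1 - 1) (by omega)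
          rw [h.label_eq_none, show 1 + (g 1 - 1 + 0) = g 1 by omega, hsub.visit] at hb
          cases hb
        · have : i = 0 := by omega
          rw [this, hsub.zero] at hi
          omega
      subst hi1
      refine ih.1 ?_
      rw [hi]
      simpa only [add_assoc] using hψ
    · refine ⟨g 1 - 1, fun k hk => ?_, ?_⟩
      · change T.label (w (1 + (k + 0))) = none
        rw [h.label_eq_none]
        refine hsub.skip _ ?_
        rintro ⟨i, hi⟩
        have h1 : i < 1 := hsub.strictMono.lt_iff_lt.1 (by omega)
        have h2 : 0 < i := hsub.strictMono.lt_iff_lt.1 (by rw [hsub.zero]; omega)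
        omega
      · have h2 := ih.2 H
        change ψ.relativize.Sat T fun i => w (1 + (g 1 - 1 + i))
        have : ∀ i, 1 + (g 1 - 1 + i) = g 1 + i := fun i => by omega
        simpa only [this] using h2
  | .untl ψ₁ ψ₂, w, v, g, hsub => by
    have hv := hsub.visit 0
    rw [hsub.zero] at hv
    have : T.label (w 0) ≠ none := by simp [h.label, hv]
    have ih₁ := fun j => Simulates.path_sat_iff h ψ₁ (hsub.shift j)
    have ih₂ := fun j => Simulates.path_sat_iff h ψ₂ (hsub.shift j)
    refine (and_iff_right this).trans ⟨?_, ?_⟩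
    · rintro ⟨n, hn, hψ⟩
      have hblank : T.label (w n) ≠ none := fun hb =>
        PathFormula.not_sat_relativize T (w := fun i => w (n + i)) hb ψ₂ hψ
      rw [ne_eq, h.label_eq_none] at hblank
      obtain ⟨j, rfl⟩ := hsub.mem_range hblank
      refine ⟨j, fun i hi => (ih₁ i).1 ?_, (ih₂ j).1 hψ⟩
      refine (hn (g i) (hsub.strictMono hi)).resolve_left fun hb => ?_
      have hb : T.label (w (g i)) = none := hb
      rw [h.label_eq_none, hsub.visit] at hb
      cases hb
    · rintro ⟨j, hj, hψ⟩
      refine ⟨g j, fun k hk => ?_, (ih₂ j).2 hψ⟩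
      by_cases hb : T.label (w k) = none
      · exact Or.inl hb
      · rw [h.label_eq_none] at hb
        obtain ⟨i, rfl⟩ := hsub.mem_range hb
        exact Or.inr ((ih₁ i).2 (hj i (hsub.strictMono.lt_iff_lt.1 hk)))
  | .always ψ, w, v, g, hsub => by
    have hv := hsub.visit 0
    rw [hsub.zero] at hv
    have : T.label (w 0) ≠ none := by simp [h.label, hv]
    have ih := fun j => Simulates.path_sat_iff h ψ (hsub.shift j)
    refine (and_iff_right this).trans ⟨fun H i => (ih i).1 ?_, fun H k => ?_⟩
    · refine (H (g i)).resolve_left fun hb => ?_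
      have hb : T.label (w (g i)) = none := hb
      rw [h.label_eq_none, hsub.visit] at hb
      cases hb
    · by_cases hb : T.label (w k) = none
      · exact Or.inl hb
      · rw [h.label_eq_none] at hb
        obtain ⟨i, rfl⟩ := hsub.mem_range hb
        exact Or.inr ((ih i).2 (H i))

end

/-! ### Path measures -/

theorem measurableSet_cylinder {S : Type} [MeasurableSpace S] [DiscreteMeasurableSpace S] (m : ℕ)
    (l : ℕ → S) : MeasurableSet {w : ℕ → S | ∀ i ≤ m, w i = l i} := by
  simp only [Set.ofPred_forall]
  refine MeasurableSet.iInter fun i => MeasurableSet.iInter fun _ => ?_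
  have hi : MeasurableSet ((fun w : ℕ → S => w i) ⁻¹' {l i}) :=
    measurable_pi_apply i MeasurableSet.of_discrete
  exact hi

theorem setOf_cylinder {S : Type} (m : ℕ) (l : ℕ → S) :
    {w : ℕ → S | ∀ i ≤ m, w i = l i} =
      Preorder.frestrictLe (π := fun _ => S) m ⁻¹'
          {Preorder.frestrictLe (π := fun _ => S) m l} := by
  ext w
  simp [funext_iff, Preorder.frestrictLe]

theorem measure_ext_of_cylinder {S : Type} [Countable S] [MeasurableSpace S]
    [DiscreteMeasurableSpace S] {μ ν : Measure (ℕ → S)} [IsFiniteMeasure μ] [IsFiniteMeasure ν]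
    (h : ∀ m (l : ℕ → S), μ {w | ∀ i ≤ m, w i = l i} = ν {w | ∀ i ≤ m, w i = l i}) : μ = ν := by
  refine IsProjectiveLimit.unique (P := fun I => ν.map I.restrict) ?_ fun I => rfl
  intro I
  have hI : ∃ m, I ⊆ Finset.Iic m := ⟨I.sup id, fun i hi => Finset.mem_Iic.2
    (Finset.le_sup (f := id) hi)⟩
  obtain ⟨m, hm⟩ := hI
  have key : μ.map (Preorder.frestrictLe m) = ν.map (Preorder.frestrictLe m) := by
    refine Measure.ext_of_singleton fun x => ?_
    rw [Measure.map_apply (by fun_prop) (MeasurableSet.singleton x),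
      Measure.map_apply (by fun_prop) (MeasurableSet.singleton x)]
    by_cases hx : ∃ l : ℕ → S, Preorder.frestrictLe m l = x
    · obtain ⟨l, rfl⟩ := hx
      rw [← setOf_cylinder]
      exact h m l
    · have : Preorder.frestrictLe (π := fun _ => S) m ⁻¹' {x} = ∅ := by
        ext w
        simp only [Set.mem_preimage, Set.mem_singleton_iff, Set.mem_empty_iff_false, iff_false]
        exact fun hw => hx ⟨w, hw⟩
      rw [this, measure_empty, measure_empty]
  have hcomp : I.restrict (π := fun _ : ℕ => S) =
      Finset.restrict₂ hm ∘ Preorder.frestrictLe m := rfl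
  rw [hcomp, ← Measure.map_map (by fun_prop) (by fun_prop), key,
    Measure.map_map (by fun_prop) (by fun_prop), ← hcomp]

/-- The path that starts with `s` and continues with `w`. -/
def consPath {S : Type} (s : S) (w : ℕ → S) : ℕ → S
  | 0 => s
  | i + 1 => w i

theorem measurable_consPath {S : Type} [MeasurableSpace S] (s : S) : Measurable (consPath s) := by
  refine measurable_pi_lambda _ fun i => ?_
  cases i with
  | zero => exact measurable_const
  | succ i => exact measurable_pi_apply i

namespace MarkovChain

variable {S A : Type} [MeasurableSpace S] [DiscreteMeasurableSpace S] (M : MarkovChain S A)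

instance (s : S) : IsProbabilityMeasure (M.pathMeasure s) := by
  unfold pathMeasure
  infer_instance

theorem partialTraj_succ_singleton [Countable S] (m : ℕ) (y : Finset.Iic m → S) (l : ℕ → S) :
    Kernel.partialTraj (X := fun _ => S) M.kernel m (m + 1) y {Preorder.frestrictLe (m + 1) l} =
      ({Preorder.frestrictLe m l} : Set (Finset.Iic m → S)).indicator
        (fun _ => M.p (l m) (l (m + 1))) y := by
  classical
  rw [Kernel.partialTraj_succ_self, Kernel.map_apply' _ (by fun_prop) _ (MeasurableSet.singleton _),
    Kernel.prod_apply, Kernel.id_apply]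
  have hset : IicProdIoc (X := fun _ => S) m (m + 1) ⁻¹' {Preorder.frestrictLe (m + 1) l} =
      {Preorder.frestrictLe m l} ×ˢ
        {(MeasurableEquiv.piSingleton (X := fun _ => S) m) (l (m + 1))} := by
    ext ⟨a, b⟩
    simp only [Set.mem_preimage, Set.mem_singleton_iff, Set.mem_prod]
    refine ⟨fun H => ⟨?_, ?_⟩, ?_⟩
    · funext i
      have := congrFun H ⟨i, Finset.mem_Iic.2 ((Finset.mem_Iic.1 i.2).trans (Nat.le_succ m))⟩
      simpa [IicProdIoc, Finset.mem_Iic.1 i.2] using this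
    · funext i
      have hi := Finset.mem_Ioc.1 i.2
      have := congrFun H ⟨i, Finset.mem_Iic.2 hi.2⟩
      rw [IicProdIoc, dif_neg (not_le.2 hi.1)] at this
      refine Eq.trans this ?_
      have him : (i : ℕ) = m + 1 := by omega
      simp [MeasurableEquiv.piSingleton, him]
    · rintro ⟨rfl, rfl⟩
      funext i
      have hi := Finset.mem_Iic.1 i.2
      by_cases him : (i : ℕ) ≤ m
      · simp [IicProdIoc, him]
      · have him' : (i : ℕ) = m + 1 := by omega
        simp [IicProdIoc, him', MeasurableEquiv.piSingleton]
  rw [hset, Measure.prod_prod, Kernel.map_apply' _ (by fun_prop) _ (MeasurableSet.singleton _)]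
  have hpre : (MeasurableEquiv.piSingleton (X := fun _ => S) m) ⁻¹'
      {(MeasurableEquiv.piSingleton (X := fun _ => S) m) (l (m + 1))} = {l (m + 1)} := by
    ext a
    simp
  rw [hpre, Measure.dirac_apply' _ (MeasurableSet.singleton _)]
  by_cases hy : y = Preorder.frestrictLe m l
  · subst hy
    simp [kernel, PMF.toMeasure_apply_singleton]
  · simp [hy]

theorem pathMeasure_cylinder [Countable S] (s : S) (m : ℕ) (l : ℕ → S) [Decidable (s = l 0)] :
    M.pathMeasure s {w | ∀ i ≤ m, w i = l i} =
      if s = l 0 then ∏ i ∈ Finset.range m, M.p (l i) (l (i + 1)) else 0 := by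
  have hpart : ∀ m, M.pathMeasure s {w | ∀ i ≤ m, w i = l i} =
      Kernel.partialTraj (X := fun _ => S) M.kernel 0 m (fun _ => s)
        {Preorder.frestrictLe m l} := by
    intro m
    rw [setOf_cylinder, pathMeasure, ← Kernel.traj_map_frestrictLe,
      Kernel.map_apply' _ (by fun_prop) _ (MeasurableSet.singleton _)]
  rw [hpart]
  induction m with
  | zero =>
    rw [Kernel.partialTraj_self, Kernel.id_apply,
        Measure.dirac_apply' _ (MeasurableSet.singleton _)]
    by_cases hs : s = l 0
    · rw [if_pos hs, Set.indicator_of_mem]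
      · simp
      · funext i
        have : (i : ℕ) = 0 := Nat.le_zero.1 (Finset.mem_Iic.1 i.2)
        simp [this, hs]
    · rw [if_neg hs, Set.indicator_of_notMem]
      exact fun h => hs (congrFun h ⟨0, Finset.mem_Iic.2 le_rfl⟩)
  | succ m ih =>
    rw [Kernel.partialTraj_succ_eq_comp (Nat.zero_le m),
      Kernel.comp_apply' _ _ _ (MeasurableSet.singleton _)]
    simp_rw [partialTraj_succ_singleton]
    rw [lintegral_indicator_const (MeasurableSet.singleton _), ih, Finset.prod_range_succ]
    split_ifs
    · rw [mul_comm]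
    · rw [mul_zero]

theorem pathMeasure_eq_sum [Countable S] (s : S) :
    M.pathMeasure s =
      Measure.sum fun s' => M.p s s' • (M.pathMeasure s').map (consPath s) := by
  classical
  have happly : ∀ E, MeasurableSet E →
      (Measure.sum fun s' => M.p s s' • (M.pathMeasure s').map (consPath s)) E =
        ∑' s', M.p s s' * M.pathMeasure s' (consPath s ⁻¹' E) := by
    intro E hE
    rw [Measure.sum_apply _ hE]
    refine tsum_congr fun s' => ?_
    rw [Measure.smul_apply, Measure.map_apply (measurable_consPath s) hE, smul_eq_mul]
  have :
      IsFiniteMeasure (Measure.sum fun s' => M.p s s' • (M.pathMeasure s').map (consPath s)) := by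
    refine ⟨?_⟩
    rw [happly _ MeasurableSet.univ]
    simp [PMF.tsum_coe]
  refine measure_ext_of_cylinder fun m l => ?_
  rw [happly _ (measurableSet_cylinder m l), pathMeasure_cylinder]
  cases m with
  | zero =>
    have hpre : consPath s ⁻¹' {w : ℕ → S | ∀ i ≤ 0, w i = l i} =
        if s = l 0 then Set.univ else ∅ := by
      ext w
      split_ifs with h <;> simp [consPath, h]
    rw [hpre]
    split_ifs <;> simp [PMF.tsum_coe]
  | succ m =>
    have hpre : consPath s ⁻¹' {w : ℕ → S | ∀ i ≤ m + 1, w i = l i} =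
        if s = l 0 then {w | ∀ i ≤ m, w i = l (i + 1)} else ∅ := by
      ext w
      split_ifs with h
      · refine ⟨fun H i hi => H (i + 1) (by omega), fun H i hi => ?_⟩
        cases i with
        | zero => exact h
        | succ i => exact H i (by omega)
      · exact iff_of_false (fun H => h (H 0 (Nat.zero_le _))) (fun H => H)
    rw [hpre]
    split_ifs with h
    · simp_rw [M.pathMeasure_cylinder _ m fun i => l (i + 1)]
      rw [tsum_eq_single (l 1) (fun s' hs' => by simp [hs']), Finset.prod_range_succ']
      simp [h, mul_comm]
    · simp

theorem pathMeasure_apply [Countable S] (s : S) {E : Set (ℕ → S)} (hE : MeasurableSet E) :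
    M.pathMeasure s E = ∑' s', M.p s s' * M.pathMeasure s' {w | consPath s w ∈ E} := by
  conv_lhs => rw [M.pathMeasure_eq_sum s]
  rw [Measure.sum_apply _ hE]
  refine tsum_congr fun s' => ?_
  rw [Measure.smul_apply, Measure.map_apply (measurable_consPath s) hE, smul_eq_mul]
  rfl

theorem ae_zero [Countable S] (s : S) : ∀ᵐ w ∂M.pathMeasure s, w 0 = s := by
  classical
  have h := M.pathMeasure_cylinder s 0 fun _ => s
  rw [if_pos rfl, Finset.prod_range_zero] at h
  have := (prob_compl_eq_zero_iff (measurableSet_cylinder 0 fun _ => s)).2 h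
  filter_upwards [measure_eq_zero_iff_ae_notMem.1 this] with w hw
  exact (not_not.1 hw) 0 le_rfl

theorem ae_isPath [Countable S] (s : S) : ∀ᵐ w ∂M.pathMeasure s, M.IsPath s w := by
  refine (M.ae_zero s).and (ae_all_iff.2 fun n => ?_)
  have hm : ∀ n, MeasurableSet {w : ℕ → S | ¬ 0 < M.p (w n) (w (n + 1))} := fun n => by
    have hp : Measurable fun w : ℕ → S => (w n, w (n + 1)) :=
      (measurable_pi_apply n).prodMk (measurable_pi_apply (n + 1))
    exact hp (MeasurableSet.of_discrete (s := {x : S × S | ¬ 0 < M.p x.1 x.2}))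
  change M.pathMeasure s {w | ¬ 0 < M.p (w n) (w (n + 1))} = 0
  induction n generalizing s with
  | zero =>
    rw [M.pathMeasure_apply s (hm 0), ENNReal.tsum_eq_zero]
    intro s'
    by_cases h : M.p s s' = 0
    · rw [h, zero_mul]
    · refine mul_eq_zero_of_right _ (measure_eq_zero_iff_ae_notMem.2 ?_)
      filter_upwards [M.ae_zero s'] with w hw
      refine not_not.2 ?_
      change 0 < M.p s (w 0)
      rw [hw]
      exact pos_iff_ne_zero.2 h
  | succ n ih =>
    rw [M.pathMeasure_apply s (hm (n + 1)), ENNReal.tsum_eq_zero]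
    exact fun s' => mul_eq_zero_of_right _ (ih s')

end MarkovChain

/-! ### The first non-blank node after the start -/

/-- The states assigned to the first `m` non-blank nodes of `w` after the start are
`l 1, …, l m`. -/
def Visits {N S : Type} (π : N → Option S) : ℕ → (ℕ → S) → (ℕ → N) → Prop
  | 0, _, _ => True
  | m + 1, l, w => ∃ k, (∀ j < k, π (w (j + 1)) = none) ∧ π (w (k + 1)) = some (l 1) ∧
      Visits π m (fun i => l (1 + i)) (fun i => w (k + 1 + i))

/-- As `Visits π (m + 1) l w`, where the first non-blank node after the start is found after at
most `K` steps. -/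
def VisitsWithin {N S : Type} (π : N → Option S) (K m : ℕ) (l : ℕ → S) (w : ℕ → N) : Prop :=
  ∃ k < K, (∀ j < k, π (w (j + 1)) = none) ∧ π (w (k + 1)) = some (l 1) ∧
    Visits π m (fun i => l (1 + i)) (fun i => w (k + 1 + i))

theorem visits_succ_iff {N S : Type} (π : N → Option S) (m : ℕ) (l : ℕ → S) (w : ℕ → N) :
    Visits π (m + 1) l w ↔ ∃ K, VisitsWithin π K m l w :=
  ⟨fun ⟨k, h⟩ => ⟨k + 1, k, Nat.lt_succ_self k, h⟩, fun ⟨_, k, _, h⟩ => ⟨k, h⟩⟩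

theorem visitsWithin_succ_consPath {N S : Type} (π : N → Option S) (K m : ℕ) (l : ℕ → S) (n : N)
    (w : ℕ → N) :
    VisitsWithin π (K + 1) m l (consPath n w) ↔
      (π (w 0) = some (l 1) ∧ Visits π m (fun i => l (1 + i)) w) ∨
        (π (w 0) = none ∧ VisitsWithin π K m l w) := by
  have hshift : ∀ k, (fun i => consPath n w (k + 1 + i)) = fun i => w (k + i) := fun k => by
    funext i
    rw [show k + 1 + i = (k + i) + 1 by omega]
    rfl
  constructor
  · rintro ⟨k, hk, hblank, hvis, hrest⟩
    rw [hshift] at hrest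
    cases k with
    | zero =>
      refine Or.inl ⟨hvis, ?_⟩
      simpa using hrest
    | succ k =>
      refine Or.inr ⟨hblank 0 (Nat.succ_pos k), k, by omega, fun j hj => ?_, hvis, hrest⟩
      exact hblank (j + 1) (by omega)
  · rintro (⟨hvis, hrest⟩ | ⟨h0, k, hk, hblank, hvis, hrest⟩)
    · refine ⟨0, Nat.succ_pos K, fun j hj => absurd hj (Nat.not_lt_zero j), hvis, ?_⟩
      rw [hshift]
      simpa using hrest
    · refine ⟨k + 1, by omega, fun j hj => ?_, hvis, ?_⟩
      · cases j with
        | zero => exact h0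
        | succ j => exact hblank j (by omega)
      · rw [hshift]
        exact hrest

theorem Subpath.visits_iff {N S : Type} {π : N → Option S} {w : ℕ → N} {v : ℕ → S} {g : ℕ → ℕ}
    (h : Subpath π w v g) {m : ℕ} {l : ℕ → S} :
    Visits π m l w ↔ ∀ i, 1 ≤ i → i ≤ m → v i = l i := by
  induction m generalizing l w v g with
  | zero => exact iff_of_true trivial fun i h1 h2 => by omega
  | succ m ih =>
    have hg1 : 0 < g 1 := h.zero ▸ h.strictMono Nat.zero_lt_one
    have hfirst : ∀ j < g 1 - 1, π (w (j + 1)) = none := by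
      intro j hj
      refine h.skip _ ?_
      rintro ⟨i, hi⟩
      have h1 : i < 1 := h.strictMono.lt_iff_lt.1 (by omega)
      have h2 : 0 < i := h.strictMono.lt_iff_lt.1 (by rw [h.zero]; omega)
      omega
    have h1 := h.visit 1
    have hg : g 1 - 1 + 1 = g 1 := by omega
    have hrest := ih (h.shift 1) (l := fun i => l (1 + i))
    constructor
    · rintro ⟨k, hblank, hvis, hv⟩
      have hk : k = g 1 - 1 := by
        rcases Nat.lt_trichotomy k (g 1 - 1) with hlt | heq | hgt
        · rw [hfirst k hlt] at hvis
          cases hvis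
        · exact heq
        · have := hblank _ hgt
          rw [hg, h1] at this
          cases this
      subst hk
      rw [hg] at hvis hv
      intro i hi1 hi2
      rcases Nat.lt_or_ge 1 i with hlt | hge
      · have := hrest.1 hv (i - 1) (by omega) (by omega)
        rwa [show 1 + (i - 1) = i by omega] at this
      · have : i = 1 := by omega
        subst this
        exact Option.some_injective _ (h1.symm.trans hvis)
    · intro H
      refine ⟨g 1 - 1, hfirst, ?_, ?_⟩
      · rw [hg, h1, H 1 le_rfl (by omega)]
      · rw [hg]
        exact hrest.2 fun i hi1 hi2 => H (1 + i) (by omega) (by omega)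

open Classical in
/-- The probability of the success of a search for `s` after a step to a node with the value `o`,
where the search goes on with probability of success `x` at a blank node. -/
noncomputable def landing {S : Type} (o : Option S) (s : S) (x : ENNReal) : ENNReal :=
  match o with
  | none => x
  | some s' => if s' = s then 1 else 0

theorem landing_none {S : Type} (s : S) (x : ENNReal) : landing none s x = x := rfl

theorem landing_self {S : Type} (s : S) (x : ENNReal) : landing (some s) s x = 1 := if_pos rfl

theorem landing_of_ne {S : Type} {s s' : S} (h : s' ≠ s) (x : ENNReal) :
    landing (some s') s x = 0 := if_neg h

/-- The probability that, from the node `n`, the first non-blank node after the start is reached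
within `K` steps and is assigned the state `s`. -/
noncomputable def MarkovChain.hit {N S A : Type} (T : MarkovChain N A) (π : N → Option S) :
    ℕ → N → S → ENNReal
  | 0, _, _ => 0
  | K + 1, n, s => ∑' n', T.p n n' * landing (π n') s (T.hit π K n' s)

section Measure

variable {N S A : Type} [Countable N] [MeasurableSpace N] [DiscreteMeasurableSpace N]

omit [Countable N] in
theorem measurableSet_visits (π : N → Option S) (m : ℕ) (l : ℕ → S) :
    MeasurableSet {w : ℕ → N | Visits π m l w} := by
  induction m generalizing l with
  | zero => exact MeasurableSet.univ
  | succ m ih =>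
    simp only [Visits, Set.ofPred_exists, Set.ofPred_and, Set.ofPred_forall]
    have hc : ∀ i (o : Option S), MeasurableSet {w : ℕ → N | π (w i) = o} := fun i o =>
      measurable_pi_apply (X := fun _ : ℕ => N) i (MeasurableSet.of_discrete (s := {n | π n = o}))
    exact MeasurableSet.iUnion fun k => (MeasurableSet.iInter fun j => MeasurableSet.iInter
      fun _ => hc _ _).inter ((hc _ _).inter
        ((measurable_pi_lambda (fun (w : ℕ → N) i => w (k + 1 + i))
          fun i => measurable_pi_apply _) (ih _)))

omit [Countable N] in
theorem measurableSet_visitsWithin (π : N → Option S) (K m : ℕ) (l : ℕ → S) :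
    MeasurableSet {w : ℕ → N | VisitsWithin π K m l w} := by
  simp only [VisitsWithin, Set.ofPred_exists, Set.ofPred_and, Set.ofPred_forall]
  have hc : ∀ i (o : Option S), MeasurableSet {w : ℕ → N | π (w i) = o} := fun i o =>
    measurable_pi_apply (X := fun _ : ℕ => N) i (MeasurableSet.of_discrete (s := {n | π n = o}))
  exact MeasurableSet.iUnion fun k => (MeasurableSet.const _).inter
    ((MeasurableSet.iInter fun j => MeasurableSet.iInter fun _ => hc _ _).inter ((hc _ _).inter
      ((measurable_pi_lambda (fun (w : ℕ → N) i => w (k + 1 + i))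
        fun i => measurable_pi_apply _) (measurableSet_visits π m _))))

theorem pathMeasure_visitsWithin (T : MarkovChain N A) (π : N → Option S) {m : ℕ} {l : ℕ → S}
    {c : ENNReal} (hc : ∀ n, π n = some (l 1) →
      T.pathMeasure n {w | Visits π m (fun i => l (1 + i)) w} = c) (K : ℕ) (n : N) :
    T.pathMeasure n {w | VisitsWithin π K m l w} = T.hit π K n (l 1) * c := by
  induction K generalizing n with
  | zero =>
    rw [MarkovChain.hit, zero_mul]
    have : {w : ℕ → N | VisitsWithin π 0 m l w} = ∅ := by
      ext w
      simp [VisitsWithin]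
    rw [this, measure_empty]
  | succ K ih =>
    rw [T.pathMeasure_apply n (measurableSet_visitsWithin π (K + 1) m l), MarkovChain.hit,
      ← ENNReal.tsum_mul_right]
    refine tsum_congr fun n' => ?_
    rw [mul_assoc]
    congr 1
    cases hn : π n' with
    | none =>
      rw [landing_none, ← ih]
      refine measure_congr ?_
      filter_upwards [T.ae_zero n'] with w hw
      refine propext ((visitsWithin_succ_consPath π K m l n w).trans ?_)
      rw [hw, hn]
      simp
      rfl
    | some s =>
      by_cases hs : s = l 1
      · rw [hs, landing_self, one_mul]
        rw [← hc n' (by rw [hn, hs])]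
        refine measure_congr ?_
        filter_upwards [T.ae_zero n'] with w hw
        refine propext ((visitsWithin_succ_consPath π K m l n w).trans ?_)
        rw [hw, hn]
        simp [hs]
        rfl
      · rw [landing_of_ne hs, zero_mul]
        refine measure_eq_zero_iff_ae_notMem.2 ?_
        filter_upwards [T.ae_zero n'] with w hw
        intro H
        have H := (visitsWithin_succ_consPath π K m l n w).1 H
        rw [hw, hn] at H
        simp [hs] at H

theorem pathMeasure_visits_succ (T : MarkovChain N A) (π : N → Option S) {m : ℕ} {l : ℕ → S}
    {c : ENNReal} (hc : ∀ n, π n = some (l 1) →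
      T.pathMeasure n {w | Visits π m (fun i => l (1 + i)) w} = c) (n : N) :
    T.pathMeasure n {w | Visits π (m + 1) l w} = (⨆ K, T.hit π K n (l 1)) * c := by
  simp only [visits_succ_iff, Set.ofPred_exists]
  rw [Monotone.measure_iUnion, ENNReal.iSup_mul]
  · exact iSup_congr fun K => pathMeasure_visitsWithin T π hc K n
  · rintro K K' hK w ⟨k, hk, h⟩
    exact ⟨k, hk.trans_le hK, h⟩

variable {B : Type} {T : MarkovChain N A} {M : MarkovChain S B} {π : N → Option S}

theorem pathMeasure_visits (h : ∀ n s, π n = some s → ∀ s', ⨆ K, T.hit π K n s' = M.p s s')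
    {m : ℕ} {l : ℕ → S} {n : N} (hn : π n = some (l 0)) :
    T.pathMeasure n {w | Visits π m l w} = ∏ i ∈ Finset.range m, M.p (l i) (l (i + 1)) := by
  induction m generalizing l n with
  | zero => simp [Visits]
  | succ m ih =>
    rw [pathMeasure_visits_succ T π (fun n' hn' => ih (l := fun i => l (1 + i)) hn') n, h n _ hn,
      Finset.prod_range_succ', mul_comm]
    congr 1
    refine Finset.prod_congr rfl fun i _ => ?_
    rw [show 1 + (i + 1) = i + 1 + 1 by omega, show 1 + i = i + 1 by omega]

theorem pathMeasure_exists_visit [Countable S] (T : MarkovChain N A) (π : N → Option S) (n : N) :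
    T.pathMeasure n {w | ∃ k, π (w (k + 1)) ≠ none} = ∑' s, ⨆ K, T.hit π K n s := by
  classical
  have hset : {w : ℕ → N | ∃ k, π (w (k + 1)) ≠ none} =
      ⋃ s : S, {w | Visits π 1 (fun _ => s) w} := by
    ext w
    simp only [Set.mem_iUnion, Visits, Set.mem_ofPred_eq, and_true]
    constructor
    · intro h
      obtain ⟨s, hs⟩ := Option.ne_none_iff_exists'.1 (Nat.find_spec h)
      exact ⟨s, Nat.find h, fun j hj => not_not.1 (Nat.find_min h hj), hs⟩
    · rintro ⟨s, k, -, hk⟩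
      exact ⟨k, by simp [hk]⟩
  rw [hset, measure_iUnion]
  · refine tsum_congr fun s => ?_
    rw [pathMeasure_visits_succ T π (m := 0) (l := fun _ => s) (c := 1) (fun _ _ => by
      simp [Visits]), mul_one]
  · intro s s' hs
    refine Set.disjoint_left.2 ?_
    rintro w ⟨k, hk, hks, -⟩ ⟨k', hk', hks', -⟩
    have hkk : k = k' := by
      rcases Nat.lt_trichotomy k k' with hlt | heq | hgt
      · rw [hk' k hlt] at hks
        cases hks
      · exact heq
      · rw [hk k' hgt] at hks'
        cases hks'
    subst hkk
    exact hs (Option.some_injective _ (hks.symm.trans hks'))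
  · exact fun s => measurableSet_visits π 1 _

theorem ae_recurrent (h : ∀ n, π n ≠ none → T.pathMeasure n {w | ∃ k, π (w (k + 1)) ≠ none} = 1)
    {n : N} (hn : π n ≠ none) :
    ∀ᵐ w ∂T.pathMeasure n, ∀ k, ∃ j, π (w (k + j)) ≠ none := by
  have hc : ∀ i, MeasurableSet {w : ℕ → N | π (w i) = none} := fun i =>
    measurable_pi_apply (X := fun _ : ℕ => N) i
      (MeasurableSet.of_discrete (s := {n | π n = none}))
  have hB : ∀ k, MeasurableSet {w : ℕ → N | ∀ j, π (w (k + 1 + j)) = none} := fun k => by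
    simp only [Set.ofPred_forall]
    exact MeasurableSet.iInter fun j => hc _
  have h0 : ∀ n, π n ≠ none → T.pathMeasure n {w | ∀ j, π (w (0 + 1 + j)) = none} = 0 := by
    intro n hn
    have := (prob_compl_eq_zero_iff (hB 0).compl (μ := T.pathMeasure n)).2 (by
      rw [← h n hn]
      congr 1
      ext w
      simp [add_comm])
    rwa [compl_compl] at this
  have hstep : ∀ k n, T.pathMeasure n {w | ∀ j, π (w (0 + 1 + j)) = none} = 0 →
      T.pathMeasure n {w | ∀ j, π (w (k + 1 + j)) = none} = 0 := by
    intro k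
    induction k with
    | zero => exact fun n h => h
    | succ k ih =>
      intro n hgood
      rw [T.pathMeasure_apply n (hB (k + 1)), ENNReal.tsum_eq_zero]
      intro n'
      by_cases hp : T.p n n' = 0
      · rw [hp, zero_mul]
      refine mul_eq_zero_of_right _ ?_
      have hshift : {w : ℕ → N | consPath n w ∈ {w : ℕ → N | ∀ j, π (w (k + 1 + 1 + j)) = none}} =
          {w | ∀ j, π (w (k + 1 + j)) = none} := by
        ext w
        refine forall_congr' fun j => ?_
        rw [show k + 1 + 1 + j = (k + 1 + j) + 1 by omega]
        rfl
      rw [hshift]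
      refine ih n' ?_
      by_cases hn' : π n' = none
      · rw [T.pathMeasure_apply n (hB 0), ENNReal.tsum_eq_zero] at hgood
        have hgood := (mul_eq_zero.1 (hgood n')).resolve_left hp
        refine measure_eq_zero_iff_ae_notMem.2 ?_
        filter_upwards [T.ae_zero n', measure_eq_zero_iff_ae_notMem.1 hgood] with w hw0 hw H
        refine hw fun j => ?_
        rw [show 0 + 1 + j = j + 1 by omega]
        change π (w j) = none
        cases j with
        | zero => rwa [hw0]
        | succ j =>
          have := H j
          rwa [show 0 + 1 + j = j + 1 by omega] at this
      · exact h0 n' hn'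
  have hk : ∀ k, ∀ᵐ w ∂T.pathMeasure n, ∃ j, π (w (k + 1 + j)) ≠ none := fun k => by
    have := measure_eq_zero_iff_ae_notMem.1 (hstep k n (h0 n hn))
    filter_upwards [this] with w hw
    simpa using hw
  filter_upwards [ae_all_iff.2 hk] with w hw k
  obtain ⟨j, hj⟩ := hw k
  exact ⟨1 + j, by rwa [← add_assoc]⟩

theorem measurable_sInf_nat {α : Type} [MeasurableSpace α] {Q : α → ℕ → Prop}
    (hQ : ∀ k, MeasurableSet {x | Q x k}) : Measurable fun x => sInf {k | Q x k} := by
  refine measurable_to_countable' fun k => ?_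
  have : (fun x => sInf {k | Q x k}) ⁻¹' {k} =
      ({x | Q x k} ∩ ⋂ j, ⋂ (_ : j < k), {x | Q x j}ᶜ) ∪
        ({_x : α | k = 0} ∩ ⋂ j, {x | Q x j}ᶜ) := by
    ext x
    simp only [Set.mem_preimage, Set.mem_singleton_iff, Set.mem_union, Set.mem_inter_iff,
      Set.mem_iInter, Set.mem_compl_iff, Set.mem_ofPred_eq]
    constructor
    · rintro rfl
      by_cases hne : {k | Q x k}.Nonempty
      · exact Or.inl ⟨Nat.sInf_mem hne, fun j hj => Nat.notMem_of_lt_sInf hj⟩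
      · rw [Set.not_nonempty_iff_eq_empty] at hne
        refine Or.inr ⟨by rw [hne, Nat.sInf_empty], fun j hj => ?_⟩
        exact (Set.ext_iff.1 hne j).1 hj
    · rintro (⟨hk, hlt⟩ | ⟨rfl, hnone⟩)
      · refine le_antisymm (Nat.sInf_le hk) ?_
        by_contra hc
        exact hlt _ (not_le.1 hc) (Nat.sInf_mem ⟨k, hk⟩)
      · rw [show {k | Q x k} = ∅ from Set.eq_empty_of_forall_notMem hnone, Nat.sInf_empty]
  rw [this]
  exact ((hQ k).inter (MeasurableSet.iInter fun j => MeasurableSet.iInter fun _ =>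
    (hQ j).compl)).union ((MeasurableSet.const _).inter (MeasurableSet.iInter fun j =>
      (hQ j).compl))

omit [Countable N] in
theorem measurable_nth (π : N → Option S) (i : ℕ) :
    Measurable fun w : ℕ → N => Nat.nth (fun k => π (w k) ≠ none) i := by
  induction i using Nat.strong_induction_on with
  | _ i ih =>
    simp_rw [fun w : ℕ → N => Nat.nth_eq_sInf (fun k => π (w k) ≠ none) i]
    refine measurable_sInf_nat fun k => ?_
    simp only [Set.ofPred_and, Set.ofPred_forall]
    refine MeasurableSet.inter ?_ (MeasurableSet.iInter fun j => MeasurableSet.iInter fun hj =>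
      ih j hj (MeasurableSet.of_discrete (s := {x | x < k})))
    exact measurable_pi_apply (X := fun _ : ℕ => N) k
      (MeasurableSet.of_discrete (s := {n | π n ≠ none}))

omit [Countable N] in
theorem measurable_extract [MeasurableSpace S] [DiscreteMeasurableSpace S] (π : N → Option S)
    (s₀ : S) : Measurable (extract π s₀) := by
  refine measurable_pi_lambda _ fun i => ?_
  have h1 : Measurable fun x : (ℕ → N) × ℕ => x.1 x.2 :=
    measurable_from_prod_countable_left fun k => measurable_pi_apply k
  have h2 := h1.comp (measurable_id.prodMk (measurable_nth π i))
  exact (Measurable.of_discrete (f := fun n => (π n).getD s₀)).comp h2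

theorem exists_visit_eq_one [Countable S]
    (h : ∀ n s, π n = some s → ∀ s', ⨆ K, T.hit π K n s' = M.p s s') {n : N} (hn : π n ≠ none) :
    T.pathMeasure n {w | ∃ k, π (w (k + 1)) ≠ none} = 1 := by
  obtain ⟨s, hs⟩ := Option.ne_none_iff_exists'.1 hn
  rw [pathMeasure_exists_visit, ← (M.p s).tsum_coe]
  exact tsum_congr fun s' => h n s hs s'

theorem map_extract [Countable S] [MeasurableSpace S] [DiscreteMeasurableSpace S]
    (h : ∀ n s, π n = some s → ∀ s', ⨆ K, T.hit π K n s' = M.p s s')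
    {n : N} {s : S} (hn : π n = some s) :
    (T.pathMeasure n).map (extract π s) = M.pathMeasure s := by
  classical
  have hmeas := measurable_extract π s
  have : IsProbabilityMeasure ((T.pathMeasure n).map (extract π s)) :=
    Measure.isProbabilityMeasure_map hmeas.aemeasurable
  have hrec := ae_recurrent (fun n hn => exists_visit_eq_one h hn) (n := n) (by simp [hn])
  refine measure_ext_of_cylinder fun m l => ?_
  rw [Measure.map_apply hmeas (measurableSet_cylinder m l), M.pathMeasure_cylinder]
  have hiff : ∀ᵐ w ∂T.pathMeasure n, (∀ i ≤ m, extract π s w i = l i) ↔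
      (s = l 0 ∧ Visits π m l w) := by
    filter_upwards [T.ae_zero n, hrec] with w hw hrec
    have hsub := subpath_extract π s (by rw [hw, hn]; simp) hrec
    have h0 := hsub.visit 0
    rw [hsub.zero, hw, hn] at h0
    have h0 := Option.some_injective _ h0
    rw [hsub.visits_iff, show (s = l 0 ↔ extract π s w 0 = l 0) by rw [← h0]]
    refine ⟨fun H => ⟨H 0 (Nat.zero_le m), fun i _ => H i⟩, fun H i hi => ?_⟩
    rcases Nat.eq_zero_or_pos i with rfl | hpos
    · exact H.1
    · exact H.2 i hpos hi
  split_ifs with hs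
  · rw [← pathMeasure_visits h (hs ▸ hn)]
    refine measure_congr ?_
    filter_upwards [hiff] with w hw
    exact propext (hw.trans (and_iff_right hs))
  · refine measure_eq_zero_iff_ae_notMem.2 ?_
    filter_upwards [hiff] with w hw
    exact fun H => hs (hw.1 H).1

end Measure

/-! ### Chains with the right hitting probabilities are simulations -/

section Hit

variable {N S A B : Type} {T : MarkovChain N A} {M : MarkovChain S B} {π : N → Option S}

theorem hit_pos {k : ℕ} {w : ℕ → N} {s : S} (hw : ∀ n, 0 < T.p (w n) (w (n + 1)))
    (hblank : ∀ j < k, π (w (j + 1)) = none) (hs : π (w (k + 1)) = some s) :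
    0 < T.hit π (k + 1) (w 0) s := by
  induction k generalizing w with
  | zero =>
    rw [MarkovChain.hit, pos_iff_ne_zero, ne_eq, ENNReal.tsum_eq_zero]
    intro H
    have := H (w 1)
    rw [hs, landing_self, mul_one] at this
    exact (hw 0).ne' this
  | succ k ih =>
    have ih := ih (w := fun i => w (i + 1)) (fun n => hw (n + 1))
      (fun j hj => hblank (j + 1) (by omega)) hs
    rw [MarkovChain.hit, pos_iff_ne_zero, ne_eq, ENNReal.tsum_eq_zero]
    intro H
    have := H (w 1)
    rw [hblank 0 (Nat.succ_pos k), landing_none] at this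
    exact (mul_eq_zero.1 this).elim (hw 0).ne' ih.ne'

theorem proj_isPath (h : ∀ n s, π n = some s → ∀ s', ⨆ K, T.hit π K n s' = M.p s s')
    {n : N} {s : S} {w : ℕ → N} {v : ℕ → S} {g : ℕ → ℕ} (hn : π n = some s)
    (hw : T.IsPath n w) (hsub : Subpath π w v g) : M.IsPath s v := by
  have h0 := hsub.visit 0
  rw [hsub.zero, hw.1, hn] at h0
  refine ⟨(Option.some_injective _ h0).symm, fun i => ?_⟩
  have hi := hsub.shift i
  have hg1 : 0 < g (i + 1) - g i := by
    have := hsub.strictMono (Nat.lt_add_one i)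
    omega
  rw [← h (w (g i)) (v i) (hsub.visit i)]
  refine lt_of_lt_of_le (hit_pos (k := g (i + 1) - g i - 1) (w := fun j => w (g i + j))
    (fun j => hw.2 _) (fun j hj => hi.skip _ ?_) ?_)
    (le_iSup (fun K => T.hit π K (w (g i)) (v (i + 1))) (g (i + 1) - g i - 1 + 1))
  · rintro ⟨j', hj'⟩
    have h1 : j' < 1 := hi.strictMono.lt_iff_lt.1 (by
      change g (i + j') - g i < g (i + 1) - g i
      change g (i + j') - g i = j + 1 at hj'
      omega)
    have : j' = 0 := by omega
    subst this
    change g (i + 0) - g i = j + 1 at hj'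
    simp at hj'
  · rw [Nat.sub_add_cancel hg1]
    exact hi.visit 1

theorem hit_succ_pos_iff {K : ℕ} {n : N} {s : S} (h : 0 < T.hit π (K + 1) n s) :
    ∃ n', 0 < T.p n n' ∧ (π n' = some s ∨ π n' = none ∧ 0 < T.hit π K n' s) := by
  rw [MarkovChain.hit, pos_iff_ne_zero, ne_eq, ENNReal.tsum_eq_zero, not_forall] at h
  obtain ⟨n', hn'⟩ := h
  rw [mul_eq_zero, not_or] at hn'
  refine ⟨n', pos_iff_ne_zero.2 hn'.1, ?_⟩
  have h2 := hn'.2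
  cases hπ : π n' with
  | none =>
    rw [hπ, landing_none] at h2
    exact Or.inr ⟨rfl, pos_iff_ne_zero.2 h2⟩
  | some s' =>
    rw [hπ] at h2
    exact Or.inl (congrArg some (not_imp_comm.1 (fun hne => landing_of_ne hne _) h2))

theorem lift_isPath (h : ∀ n s, π n = some s → ∀ s', ⨆ K, T.hit π K n s' = M.p s s')
    {n : N} {s : S} {v : ℕ → S} (hn : π n = some s) (hv : M.IsPath s v) :
    ∃ w g, T.IsPath n w ∧ Subpath π w v g := by
  let Q := {x : N × ℕ × ℕ // 0 < T.hit π x.2.2 x.1 (v (x.2.1 + 1))}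
  have hvisit : ∀ n i, π n = some (v i) → ∃ K, 0 < T.hit π K n (v (i + 1)) := by
    intro n i hn
    have := hv.2 i
    rwa [← h n (v i) hn, lt_iSup_iff] at this
  have hstep : ∀ x : Q, ∃ y : Q, 0 < T.p x.1.1 y.1.1 ∧
      ((π y.1.1 = none ∧ y.1.2.1 = x.1.2.1 ∧ y.1.2.2 < x.1.2.2) ∨
        (y.1.2.1 = x.1.2.1 + 1 ∧ π y.1.1 = some (v y.1.2.1))) := by
    rintro ⟨⟨n, i, K⟩, hx⟩
    cases K with
    | zero => exact absurd hx (by simp [MarkovChain.hit])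
    | succ K =>
      obtain ⟨n', hp, hn' | ⟨hn', hK⟩⟩ := hit_succ_pos_iff hx
      · obtain ⟨K', hK'⟩ := hvisit n' (i + 1) hn'
        exact ⟨⟨⟨n', i + 1, K'⟩, hK'⟩, hp, Or.inr ⟨rfl, hn'⟩⟩
      · exact ⟨⟨⟨n', i, K⟩, hK⟩, hp, Or.inl ⟨hn', rfl, Nat.lt_succ_self K⟩⟩
  choose step hp hcase using hstep
  have hn0 : π n = some (v 0) := by rw [hn, hv.1]
  obtain ⟨K₀, hK₀⟩ := hvisit n 0 hn0
  let r : ℕ → Q := fun k => step^[k] ⟨⟨n, 0, K₀⟩, hK₀⟩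
  have hr : ∀ k, r (k + 1) = step (r k) := fun k => Function.iterate_succ_apply' _ _ _
  let w : ℕ → N := fun k => (r k).1.1
  have hwp : T.IsPath n w := by
    refine ⟨rfl, fun k => ?_⟩
    change 0 < T.p (r k).1.1 (r (k + 1)).1.1
    rw [hr]
    exact hp _
  have hrec : ∀ K k, (r k).1.2.2 ≤ K → ∃ j, π (w (k + 1 + j)) ≠ none := by
    intro K
    induction K with
    | zero =>
      intro k hk
      refine ⟨0, ?_⟩
      change π (r (k + 1)).1.1 ≠ none
      rw [hr]
      rcases hcase (r k) with h1 | h1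
      · omega
      · rw [h1.2]
        simp
    | succ K ih =>
      intro k hk
      by_cases hb : π (w (k + 1)) = none
      · have : (r (k + 1)).1.2.2 ≤ K := by
          change π (r (k + 1)).1.1 = none at hb
          rw [hr] at hb ⊢
          rcases hcase (r k) with h1 | h1
          · omega
          · rw [h1.2] at hb
            cases hb
        obtain ⟨j, hj⟩ := ih (k + 1) this
        exact ⟨1 + j, by rwa [← add_assoc]⟩
      · exact ⟨0, hb⟩
  have hsub := subpath_extract π s (w := w) (by change π n ≠ none; simp [hn]) fun k => by
    obtain ⟨j, hj⟩ := hrec _ k le_rfl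
    exact ⟨1 + j, by rwa [← add_assoc]⟩
  set g := Nat.nth fun k => π (w k) ≠ none
  refine ⟨w, g, hwp, hsub.strictMono, hsub.zero, fun i => ?_, hsub.skip⟩
  have hidx : ∀ k, ∃ i, g i ≤ k ∧ k < g (i + 1) ∧ (r k).1.2.1 = i := by
    intro k
    induction k with
    | zero => exact ⟨0, hsub.zero.le, hsub.zero.symm.trans_lt (hsub.strictMono Nat.zero_lt_one),
        rfl⟩
    | succ k ih =>
      obtain ⟨i, h1, h2, h3⟩ := ih
      have hc := hcase (r k)
      rw [← hr] at hc
      rcases hc with hc | hc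
      · refine ⟨i, by omega, lt_of_le_of_ne h2 fun heq => ?_, by omega⟩
        have hv' := hsub.visit (i + 1)
        rw [← heq] at hv'
        have hv' : π (r (k + 1)).1.1 = _ := hv'
        rw [hc.1] at hv'
        cases hv'
      · obtain ⟨i', hi'⟩ := hsub.mem_range (k := k + 1) (by
          change π (r (k + 1)).1.1 ≠ none
          rw [hc.2]
          simp)
        have h4 : i < i' := hsub.strictMono.lt_iff_lt.1 (by omega)
        have h5 : g (i + 1) ≤ g i' := hsub.strictMono.monotone h4
        have h6 : g (i + 1) = k + 1 := by omega
        have h7 := hsub.strictMono (Nat.lt_add_one (i + 1))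
        exact ⟨i + 1, h6.le, by rw [← h6]; exact h7, by omega⟩
  obtain ⟨i', h1, h2, h3⟩ := hidx (g i)
  have h4 : i' ≤ i := hsub.strictMono.le_iff_le.1 h1
  have h5 : i < i' + 1 := hsub.strictMono.lt_iff_lt.1 h2
  have h6 : i' = i := by omega
  have hval : ∀ k, π (w k) ≠ none → π (w k) = some (v (r k).1.2.1) := by
    intro k hk
    cases k with
    | zero => exact hn0
    | succ k =>
      change π (r (k + 1)).1.1 ≠ none at hk
      change π (r (k + 1)).1.1 = _
      have hc := hcase (r k)
      rw [← hr] at hc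
      rcases hc with hc | hc
      · exact absurd hc.1 hk
      · exact hc.2
  rw [hval (g i) (by rw [hsub.visit]; simp), h3, h6]

end Hit

theorem simulates_of_hit {N S A : Type} [Countable N] [Countable S]
    {T : MarkovChain N (Option A)} {M : MarkovChain S A} {π : N → Option S}
    (hlabel : ∀ n, T.label n = (π n).map M.label)
    (h : ∀ n s, π n = some s → ∀ s', ⨆ K, T.hit π K n s' = M.p s s') : Simulates T M π where
  label := hlabel
  proj := proj_isPath h
  lift := lift_isPath h
  prob := by
    intro n s D E hn hE hDE
    let _ : MeasurableSpace N := ⊤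
    have : DiscreteMeasurableSpace N := ⟨fun _ => trivial⟩
    let _ : MeasurableSpace S := ⊤
    have : DiscreteMeasurableSpace S := ⟨fun _ => trivial⟩
    change T.pathMeasure n D = M.pathMeasure s E
    rw [← map_extract h hn, Measure.map_apply (measurable_extract π s) hE]
    refine measure_congr ?_
    have hrec := ae_recurrent (fun n hn => exists_visit_eq_one h hn) (n := n) (by simp [hn])
    filter_upwards [T.ae_isPath n, hrec] with w hw hrec
    exact propext (hDE w _ _ hw (subpath_extract π s (by rw [hw.1, hn]; simp) hrec))

/-! ### From binary trees to Markov chains -/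

theorem tsum_treeChain {A : Type} (t : List Bool → A) (n : List Bool) (F : List Bool → ENNReal) :
    ∑' n', (treeChain t).p n n' * F n' = 2⁻¹ * F (n ++ [false]) + 2⁻¹ * F (n ++ [true]) := by
  classical
  have h : ∀ n', (treeChain t).p n n' * F n' =
      ∑' b : Bool, (if n' = n ++ [b] then 2⁻¹ * F (n ++ [b]) else 0) := by
    intro n'
    rw [treeChain, PMF.map_apply, ← ENNReal.tsum_mul_right]
    refine tsum_congr fun b => ?_
    split_ifs with hb
    · simp [hb]
    · rw [zero_mul]
  simp_rw [h]
  rw [ENNReal.tsum_comm]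
  simp only [tsum_ite_eq]
  rw [tsum_bool]

theorem treeChain_p_append {A : Type} (t : List Bool → A) (n : List Bool) (b : Bool) :
    (treeChain t).p n (n ++ [b]) ≠ 0 := by
  rw [← PMF.mem_support_iff, treeChain, PMF.mem_support_map_iff]
  exact ⟨b, by simp, rfl⟩

theorem MarkovChain.ae_consPath {S A : Type} [Countable S] [MeasurableSpace S]
    [DiscreteMeasurableSpace S] (M : MarkovChain S A) {s s' : S} {E : Set (ℕ → S)}
    (hE : MeasurableSet E) (hs : M.p s s' ≠ 0) (h : ∀ᵐ w ∂M.pathMeasure s, w ∈ E) :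
    ∀ᵐ w ∂M.pathMeasure s', consPath s w ∈ E := by
  have h : M.pathMeasure s Eᶜ = 0 := h
  rw [M.pathMeasure_apply s hE.compl, ENNReal.tsum_eq_zero] at h
  exact (mul_eq_zero.1 (h s')).resolve_left hs

/-- The states of the chain decoded from a tree: the non-blank nodes. -/
abbrev NonBlankNode {A : Type} (t : List Bool → Option A) : Type := {n : List Bool // t n ≠ none}

open Classical in
/-- A node as a state of the decoded chain. -/
noncomputable def toNonBlankNode {A : Type} (t : List Bool → Option A) (n : List Bool) :
    Option (NonBlankNode t) :=
  if h : t n ≠ none then some ⟨n, h⟩ else none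

theorem toNonBlankNode_eq_none {A : Type} (t : List Bool → Option A) (n : List Bool) :
    toNonBlankNode t n = none ↔ t n = none := by
  unfold toNonBlankNode
  split_ifs with h
  · exact iff_of_false (by simp) h
  · exact iff_of_true rfl (not_not.1 h)

theorem toNonBlankNode_eq_some {A : Type} {t : List Bool → Option A} {n : List Bool}
    {s : NonBlankNode t} (h : toNonBlankNode t n = some s) : s.1 = n := by
  unfold toNonBlankNode at h
  split_ifs at h
  rw [← Option.some_injective _ h]

/-- The chain decoded from a tree: it moves to the first non-blank node met by a random branch. -/
noncomputable def decodedChain {A : Type} (t : List Bool → Option A)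
    (h : ∀ n, ∑' s, ⨆ K, (treeChain t).hit (toNonBlankNode t) K n s = 1) :
    MarkovChain (NonBlankNode t) A where
  p s := ⟨fun s' => ⨆ K, (treeChain t).hit (toNonBlankNode t) K s.1 s',
    h s.1 ▸ ENNReal.summable.hasSum⟩
  label s := (t s.1).get (Option.isSome_iff_ne_none.2 s.2)

theorem simulates_decodedChain {A : Type} (t : List Bool → Option A)
    (h : ∀ n, ∑' s, ⨆ K, (treeChain t).hit (toNonBlankNode t) K n s = 1) :
    Simulates (treeChain t) (decodedChain t h) (toNonBlankNode t) := by
  refine simulates_of_hit (fun n => ?_) fun n s hn s' => ?_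
  · change t n = _
    cases hn : toNonBlankNode t n with
    | none => exact (toNonBlankNode_eq_none t n).1 hn
    | some s =>
      obtain rfl := toNonBlankNode_eq_some hn
      simp [decodedChain]
  · obtain rfl := toNonBlankNode_eq_some hn
    rfl

theorem mcSat_of_binSat {A : Type} {φ : StateFormula A} (h : BinSat φ.toTree) : MCSat φ := by
  obtain ⟨t, hrec, hφ⟩ := h
  let _ : MeasurableSpace (List Bool) := ⊤
  have : DiscreteMeasurableSpace (List Bool) := ⟨fun _ => trivial⟩
  have hroot : t [] ≠ none := fun h0 => StateFormula.not_sat_relativize (treeChain t) h0 φ hφ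
  have hR : MeasurableSet {w | (recurNonBlank (A := A)).Sat (treeChain t) w} :=
    measurableSet_sat (treeChain t) recurNonBlank
  have hrec : ∀ᵐ w ∂(treeChain t).pathMeasure [], (treeChain t).IsPath [] w ∧
      (recurNonBlank (A := A)).Sat (treeChain t) w :=
    (mem_ae_iff_prob_eq_one ((measurableSet_isPath (treeChain t) []).inter hR)).2 hrec
  have hall : ∀ n : List Bool, ∀ᵐ w ∂(treeChain t).pathMeasure n,
      (recurNonBlank (A := A)).Sat (treeChain t) w := by
    intro n
    induction n using List.reverseRecOn with
    | nil => exact hrec.mono fun w hw => hw.2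
    | append_singleton n b ih =>
      refine ((treeChain t).ae_consPath hR (treeChain_p_append t n b) ih).mono fun w hw => ?_
      refine (sat_recurNonBlank _ _).2 fun k => ?_
      obtain ⟨j, hj⟩ := (sat_recurNonBlank _ _).1 hw (k + 1)
      refine ⟨j, ?_⟩
      rwa [show k + 1 + j = (k + j) + 1 by omega] at hj
  have hsum : ∀ n, ∑' s, ⨆ K, (treeChain t).hit (toNonBlankNode t) K n s = 1 := by
    intro n
    rw [← pathMeasure_exists_visit, ← measure_univ (μ := (treeChain t).pathMeasure n)]
    refine measure_congr ?_
    filter_upwards [hall n] with w hw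
    refine propext (iff_of_true ?_ trivial)
    obtain ⟨j, hj⟩ := (sat_recurNonBlank _ _).1 hw 1
    refine ⟨j, fun hc => hj ?_⟩
    rw [add_comm]
    exact (toNonBlankNode_eq_none t _).1 hc
  refine ⟨NonBlankNode t, inferInstance, decodedChain t hsum, ⟨[], hroot⟩, ?_⟩
  refine ((simulates_decodedChain t hsum).sat_iff φ ?_).1 hφ
  rw [toNonBlankNode, dif_pos hroot]

/-! ### From Markov chains to binary trees -/

/-- Truncation of a real number to the unit interval. -/
noncomputable def clamp (x : ℝ) : ℝ := max 0 (min 1 x)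

theorem clamp_of_nonpos {x : ℝ} (h : x ≤ 0) : clamp x = 0 :=
  max_eq_left ((min_le_right _ _).trans h)

theorem clamp_of_one_le {x : ℝ} (h : 1 ≤ x) : clamp x = 1 := by
  rw [clamp, min_eq_left h, max_eq_right zero_le_one]

theorem clamp_of_mem {x : ℝ} (h0 : 0 ≤ x) (h1 : x ≤ 1) : clamp x = x := by
  rw [clamp, min_eq_right h1, max_eq_right h0]

theorem clamp_mono {x y : ℝ} (h : x ≤ y) : clamp x ≤ clamp y :=
  max_le_max le_rfl (min_le_min le_rfl h)

theorem clamp_nonneg (x : ℝ) : 0 ≤ clamp x := le_max_left _ _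

theorem clamp_le_one (x : ℝ) : clamp x ≤ 1 := max_le zero_le_one (min_le_left _ _)

theorem clamp_eq_half (x : ℝ) : clamp x = (clamp (2 * x) + clamp (2 * x - 1)) / 2 := by
  rcases le_total x 0 with h0 | h0
  · rw [clamp_of_nonpos h0, clamp_of_nonpos (by linarith), clamp_of_nonpos (by linarith)]
    norm_num
  rcases le_total 1 x with h1 | h1
  · rw [clamp_of_one_le h1, clamp_of_one_le (by linarith), clamp_of_one_le (by linarith)]
    norm_num
  rw [clamp_of_mem h0 h1]
  rcases le_total (2 * x) 1 with h2 | h2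
  · rw [clamp_of_mem (by linarith) h2, clamp_of_nonpos (by linarith)]
    ring
  · rw [clamp_of_one_le h2, clamp_of_mem (by linarith) (by linarith)]
    ring

open Classical in
/-- The probability that `K` random bits do not separate `x` from a uniformly distributed point
of the unit interval, up to a bound. -/
noncomputable def undecided (K : ℕ) (x : ℝ) : ℝ := if 0 < x ∧ x < 1 then (1 / 2) ^ K else 0

theorem undecided_le (K : ℕ) (x : ℝ) : undecided K x ≤ (1 / 2) ^ K := by
  unfold undecided
  split_ifs
  · exact le_rfl
  · positivity

theorem undecided_nonneg (K : ℕ) (x : ℝ) : 0 ≤ undecided K x := by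
  unfold undecided
  split_ifs
  · positivity
  · exact le_rfl

theorem half_undecided_le (K : ℕ) (x : ℝ) :
    (undecided K (2 * x) + undecided K (2 * x - 1)) / 2 ≤ undecided (K + 1) x := by
  have hK : (0 : ℝ) ≤ (1 / 2) ^ K := by positivity
  unfold undecided
  rw [pow_succ]
  split_ifs with h1 h2 h3 h3 h3 h3 h3 <;> first | linarith | skip
  · exact absurd ⟨by linarith [h1.1], by linarith [h1.2]⟩ h3
  · rename_i h2
    exact absurd ⟨by linarith [h2.1], by linarith [h2.2]⟩ h3

section Encode

variable {S A : Type} (e : S → ℕ)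

/-- The distribution function of the image of `p` under `e`. -/
noncomputable def cdfNat (p : PMF S) (i : ℕ) : ℝ := ∑ j ∈ Finset.range i, ((p.map e) j).toReal

theorem cdfNat_mono (p : PMF S) : Monotone (cdfNat e p) :=
  monotone_nat_of_le_succ fun i => by
    rw [cdfNat, cdfNat, Finset.sum_range_succ]
    exact le_add_of_nonneg_right ENNReal.toReal_nonneg

theorem cdfNat_nonneg (p : PMF S) (i : ℕ) : 0 ≤ cdfNat e p i :=
  Finset.sum_nonneg fun _ _ => ENNReal.toReal_nonneg

theorem cdfNat_le_one (p : PMF S) (i : ℕ) : cdfNat e p i ≤ 1 := by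
  rw [cdfNat, ← ENNReal.toReal_sum fun j _ => PMF.apply_ne_top _ _]
  refine ENNReal.toReal_le_of_le_ofReal zero_le_one ?_
  rw [ENNReal.ofReal_one, ← (p.map e).tsum_coe]
  exact ENNReal.sum_le_tsum _

theorem cdfNat_succ_sub (he : Function.Injective e) (p : PMF S) (s : S) :
    cdfNat e p (e s + 1) - cdfNat e p (e s) = (p s).toReal := by
  classical
  rw [cdfNat, cdfNat, Finset.sum_range_succ, add_sub_cancel_left, PMF.map_apply,
    tsum_eq_single s]
  · rw [if_pos rfl]
  · exact fun s' hs' => if_neg fun h => hs' (he h).symm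

/-- The unit interval lies between the `s`-th and the following point of subdivision. -/
def Decided (y : ℕ → ℝ) (s : S) : Prop := y (e s) ≤ 0 ∧ 1 ≤ y (e s + 1)

/-- The subdivision `y` as seen from the half `b` of the unit interval. -/
def zoom (y : ℕ → ℝ) (b : Bool) (i : ℕ) : ℝ := 2 * y i - if b then 1 else 0

theorem zoom_mono {y : ℕ → ℝ} (hy : Monotone y) (b : Bool) : Monotone (zoom y b) :=
  fun i j hij => by
    have := hy hij
    unfold zoom
    linarith

theorem Decided.unique {y : ℕ → ℝ} (hy : Monotone y) {s s' : S} (h : Decided e y s)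
    (hs : s' ≠ s) (he : Function.Injective e) : clamp (y (e s' + 1)) - clamp (y (e s')) = 0 := by
  rcases lt_or_gt_of_ne (he.ne hs) with hlt | hgt
  · have h1 : y (e s' + 1) ≤ 0 := (hy hlt).trans h.1
    have h2 : y (e s') ≤ 0 := (hy (Nat.le_succ _)).trans h1
    rw [clamp_of_nonpos h1, clamp_of_nonpos h2, sub_zero]
  · have h1 : 1 ≤ y (e s') := h.2.trans (hy hgt)
    have h2 : 1 ≤ y (e s' + 1) := h1.trans (hy (Nat.le_succ _))
    rw [clamp_of_one_le h1, clamp_of_one_le h2, sub_self]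

variable (M : MarkovChain S A)

open Classical in
/-- One step of the automaton that selects the next state of `M` by random bits. -/
noncomputable def selectStep (x : Option S × (ℕ → ℝ)) (b : Bool) : Option S × (ℕ → ℝ) :=
  if h : ∃ s, Decided e (zoom x.2 b) s then (some h.choose, cdfNat e (M.p h.choose))
  else (none, zoom x.2 b)

/-- The state of the automaton at a node of the binary tree, the root being a start in `s₀`. -/
noncomputable def selectRun (s₀ : S) (n : List Bool) : Option S × (ℕ → ℝ) :=
  n.foldl (selectStep e M) (some s₀, cdfNat e (M.p s₀))

theorem selectRun_append (s₀ : S) (n : List Bool) (b : Bool) :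
    selectRun e M s₀ (n ++ [b]) = selectStep e M (selectRun e M s₀ n) b := by
  rw [selectRun, List.foldl_append]
  rfl

theorem selectStep_mono {x : Option S × (ℕ → ℝ)} (hx : Monotone x.2) (b : Bool) :
    Monotone (selectStep e M x b).2 := by
  unfold selectStep
  split_ifs with h
  · exact cdfNat_mono e _
  · exact zoom_mono hx b

theorem selectRun_mono (s₀ : S) (n : List Bool) : Monotone (selectRun e M s₀ n).2 := by
  induction n using List.reverseRecOn with
  | nil => exact cdfNat_mono e _
  | append_singleton n b ih =>
    rw [selectRun_append]
    exact selectStep_mono e M ih b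

theorem selectStep_cases (x : Option S × (ℕ → ℝ)) (b : Bool) :
    (∃ s, Decided e (zoom x.2 b) s ∧ selectStep e M x b = (some s, cdfNat e (M.p s))) ∨
      ((∀ s, ¬ Decided e (zoom x.2 b) s) ∧ selectStep e M x b = (none, zoom x.2 b)) := by
  unfold selectStep
  split_ifs with h
  · exact Or.inl ⟨h.choose, h.choose_spec, rfl⟩
  · exact Or.inr ⟨not_exists.1 h, rfl⟩

theorem selectRun_of_some (s₀ : S) {n : List Bool} {s : S} (h : (selectRun e M s₀ n).1 = some s) :
    (selectRun e M s₀ n).2 = cdfNat e (M.p s) := by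
  induction n using List.reverseRecOn with
  | nil =>
    have : s₀ = s := Option.some_injective _ h
    subst this
    rfl
  | append_singleton n b ih =>
    rw [selectRun_append] at h ⊢
    rcases selectStep_cases e M (selectRun e M s₀ n) b with ⟨s', -, hs'⟩ | ⟨-, hs'⟩
    · rw [hs'] at h ⊢
      have : s' = s := Option.some_injective _ h
      subst this
      rfl
    · rw [hs'] at h
      cases h

/-- The mass that the subdivision `y` of the unit interval gives to the state `s`. -/
noncomputable def massOf (y : ℕ → ℝ) (s : S) : ℝ := clamp (y (e s + 1)) - clamp (y (e s))

theorem massOf_nonneg {y : ℕ → ℝ} (hy : Monotone y) (s : S) : 0 ≤ massOf e y s :=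
  sub_nonneg.2 (clamp_mono (hy (Nat.le_succ _)))

theorem massOf_le_one (y : ℕ → ℝ) (s : S) : massOf e y s ≤ 1 := by
  have := clamp_le_one (y (e s + 1))
  have := clamp_nonneg (y (e s))
  unfold massOf
  linarith

theorem massOf_eq_half (y : ℕ → ℝ) (s : S) :
    massOf e y s = (massOf e (zoom y false) s + massOf e (zoom y true) s) / 2 := by
  have h1 := clamp_eq_half (y (e s + 1))
  have h2 := clamp_eq_half (y (e s))
  simp only [massOf, zoom, Bool.false_eq_true, if_false, if_true, sub_zero]
  linarith

theorem half_ofReal_add {a b : ℝ} (ha : 0 ≤ a) (hb : 0 ≤ b) :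
    2⁻¹ * ENNReal.ofReal a + 2⁻¹ * ENNReal.ofReal b = ENNReal.ofReal ((a + b) / 2) := by
  have h2 : (2⁻¹ : ENNReal) = ENNReal.ofReal (2⁻¹) := by
    rw [ENNReal.ofReal_inv_of_pos two_pos, ENNReal.ofReal_ofNat]
  rw [h2, ← ENNReal.ofReal_mul (by norm_num), ← ENNReal.ofReal_mul (by norm_num),
    ← ENNReal.ofReal_add (by positivity) (by positivity)]
  congr 1
  ring

theorem ofReal_half_add_le (a b : ℝ) :
    ENNReal.ofReal ((a + b) / 2) ≤ 2⁻¹ * ENNReal.ofReal a + 2⁻¹ * ENNReal.ofReal b := by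
  have h2 : (2⁻¹ : ENNReal) = ENNReal.ofReal (2⁻¹) := by
    rw [ENNReal.ofReal_inv_of_pos two_pos, ENNReal.ofReal_ofNat]
  rw [h2, ← ENNReal.ofReal_mul (by norm_num), ← ENNReal.ofReal_mul (by norm_num)]
  refine le_trans (le_of_eq ?_) ENNReal.ofReal_add_le
  congr 1
  ring

theorem hit_treeChain_succ {B : Type} (t : List Bool → B) (π : List Bool → Option S) (s : S)
    (K : ℕ) (n : List Bool) :
    (treeChain t).hit π (K + 1) n s =
      2⁻¹ * landing (π (n ++ [false])) s ((treeChain t).hit π K (n ++ [false]) s) +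
        2⁻¹ * landing (π (n ++ [true])) s ((treeChain t).hit π K (n ++ [true]) s) := by
  rw [MarkovChain.hit, tsum_treeChain t n fun n' =>
    landing (π n') s ((treeChain t).hit π K n' s)]

theorem hit_select_le {B : Type} (t : List Bool → B) (s₀ s : S) (K : ℕ) (n : List Bool) :
    (treeChain t).hit (fun n => (selectRun e M s₀ n).1) K n s ≤
      ENNReal.ofReal (massOf e (selectRun e M s₀ n).2 s) := by
  induction K generalizing n with
  | zero => exact zero_le
  | succ K ih =>
    have hy := selectRun_mono e M s₀ n
    rw [hit_treeChain_succ, massOf_eq_half, ← half_ofReal_add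
      (massOf_nonneg e (zoom_mono hy _) s) (massOf_nonneg e (zoom_mono hy _) s)]
    have key : ∀ b, landing (selectRun e M s₀ (n ++ [b])).1 s
        ((treeChain t).hit (fun n => (selectRun e M s₀ n).1) K (n ++ [b]) s) ≤
          ENNReal.ofReal (massOf e (zoom (selectRun e M s₀ n).2 b) s) := by
      intro b
      have ih := ih (n ++ [b])
      rcases selectStep_cases e M (selectRun e M s₀ n) b with ⟨s', hd, hs'⟩ | ⟨-, hs'⟩
      · rw [← selectRun_append] at hs'
        rw [hs']
        by_cases hss : s' = s
        · subst hss
          rw [landing_self, massOf, clamp_of_one_le hd.2, clamp_of_nonpos hd.1]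
          simp
        · rw [landing_of_ne hss]
          exact zero_le
      · rw [← selectRun_append] at hs'
        rw [hs'] at ih
        rw [hs']
        exact ih
    exact add_le_add (mul_le_mul_right (key false) _) (mul_le_mul_right (key true) _)

theorem le_hit_select (he : Function.Injective e) {B : Type} (t : List Bool → B) (s₀ s : S)
    (K : ℕ) (n : List Bool) (hK : K = 0 → ¬ Decided e (selectRun e M s₀ n).2 s) :
    ENNReal.ofReal (massOf e (selectRun e M s₀ n).2 s -
        (undecided K ((selectRun e M s₀ n).2 (e s)) +
          undecided K ((selectRun e M s₀ n).2 (e s + 1)))) ≤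
      (treeChain t).hit (fun n => (selectRun e M s₀ n).1) K n s := by
  induction K generalizing n with
  | zero =>
    have hK := hK rfl
    have hy := selectRun_mono e M s₀ n (Nat.le_succ (e s))
    set y := (selectRun e M s₀ n).2
    refine (ENNReal.ofReal_of_nonpos ?_).trans_le (zero_le)
    have h1 := massOf_le_one e y s
    have hn1 := undecided_nonneg 0 (y (e s))
    have hn2 := undecided_nonneg 0 (y (e s + 1))
    by_cases ha : 0 < y (e s) ∧ y (e s) < 1
    · have : undecided 0 (y (e s)) = 1 := by simp [undecided, ha]
      linarith
    by_cases hb : 0 < y (e s + 1) ∧ y (e s + 1) < 1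
    · have : undecided 0 (y (e s + 1)) = 1 := by simp [undecided, hb]
      linarith
    have h0 : massOf e y s = 0 := by
      rw [not_and, not_lt] at ha hb
      rcases le_or_gt (y (e s)) 0 with h | h
      · rcases le_or_gt (y (e s + 1)) 0 with h' | h'
        · rw [massOf, clamp_of_nonpos h, clamp_of_nonpos h', sub_zero]
        · exact absurd ⟨h, hb h'⟩ hK
      · have h2 := ha h
        rw [massOf, clamp_of_one_le h2, clamp_of_one_le (h2.trans hy), sub_self]
    linarith
  | succ K ih =>
    have hy := selectRun_mono e M s₀ n
    have key : ∀ b, ENNReal.ofReal (massOf e (zoom (selectRun e M s₀ n).2 b) s -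
        (undecided K (zoom (selectRun e M s₀ n).2 b (e s)) +
          undecided K (zoom (selectRun e M s₀ n).2 b (e s + 1)))) ≤
        landing (selectRun e M s₀ (n ++ [b])).1 s
        ((treeChain t).hit (fun n => (selectRun e M s₀ n).1) K (n ++ [b]) s) := by
      intro b
      have ih := ih (n ++ [b])
      have hn1 := undecided_nonneg K (zoom (selectRun e M s₀ n).2 b (e s))
      have hn2 := undecided_nonneg K (zoom (selectRun e M s₀ n).2 b (e s + 1))
      rcases selectStep_cases e M (selectRun e M s₀ n) b with ⟨s', hd, hs'⟩ | ⟨hnd, hs'⟩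
      · rw [← selectRun_append] at hs'
        rw [hs']
        by_cases hss : s' = s
        · rw [hss, landing_self]
          refine ENNReal.ofReal_le_one.2 ?_
          have := massOf_le_one e (zoom (selectRun e M s₀ n).2 b) s
          linarith
        · rw [landing_of_ne hss]
          refine (ENNReal.ofReal_of_nonpos ?_).le
          have := hd.unique e (zoom_mono hy b) (Ne.symm hss) he
          rw [massOf]
          linarith
      · rw [← selectRun_append] at hs'
        rw [hs'] at ih
        rw [hs']
        exact ih fun _ => hnd s
    rw [hit_treeChain_succ]
    refine le_trans (le_trans (ENNReal.ofReal_le_ofReal ?_) (ofReal_half_add_le _ _))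
      (add_le_add (mul_le_mul_right (key false) _) (mul_le_mul_right (key true) _))
    have h1 := half_undecided_le K ((selectRun e M s₀ n).2 (e s))
    have h2 := half_undecided_le K ((selectRun e M s₀ n).2 (e s + 1))
    rw [massOf_eq_half]
    simp only [zoom, Bool.false_eq_true, if_false, if_true, sub_zero]
    linarith

theorem iSup_hit_select (he : Function.Injective e) {B : Type} (t : List Bool → B) (s₀ : S)
    {n : List Bool} {s : S} (hn : (selectRun e M s₀ n).1 = some s) (s' : S) :
    ⨆ K, (treeChain t).hit (fun n => (selectRun e M s₀ n).1) K n s' = M.p s s' := by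
  have hmass : massOf e (selectRun e M s₀ n).2 s' = (M.p s s').toReal := by
    rw [selectRun_of_some e M s₀ hn, massOf, clamp_of_mem (cdfNat_nonneg _ _ _)
      (cdfNat_le_one _ _ _), clamp_of_mem (cdfNat_nonneg _ _ _) (cdfNat_le_one _ _ _),
      cdfNat_succ_sub e he]
  refine le_antisymm (iSup_le fun K => ?_) ?_
  · refine (hit_select_le e M t s₀ s' K n).trans_eq ?_
    rw [hmass, ENNReal.ofReal_toReal (PMF.apply_ne_top _ _)]
  · have hlim : Filter.Tendsto (fun K : ℕ => ENNReal.ofReal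
        ((M.p s s').toReal - ((1 / 2) ^ (K + 1) + (1 / 2) ^ (K + 1)))) Filter.atTop
        (nhds (M.p s s')) := by
      have h0 : Filter.Tendsto (fun K : ℕ => ((1 : ℝ) / 2) ^ (K + 1)) Filter.atTop (nhds 0) :=
        (tendsto_pow_atTop_nhds_zero_of_lt_one (by norm_num) (by norm_num)).comp
          (Filter.tendsto_add_atTop_nat 1)
      have h1 := (h0.add h0).const_sub (M.p s s').toReal
      have h2 := ENNReal.tendsto_ofReal h1
      rwa [add_zero, sub_zero, ENNReal.ofReal_toReal (PMF.apply_ne_top _ _)] at h2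
    refine le_of_tendsto' hlim fun K => ?_
    refine le_trans (le_trans (ENNReal.ofReal_le_ofReal ?_)
      (le_hit_select e M he t s₀ s' (K + 1) n (fun h => absurd h (Nat.succ_ne_zero K))))
      (le_iSup (fun K => (treeChain t).hit (fun n => (selectRun e M s₀ n).1) K n s') (K + 1))
    rw [hmass]
    exact sub_le_sub_left (add_le_add (undecided_le _ _) (undecided_le _ _)) _

end Encode

theorem binSat_of_mcSat {A : Type} {φ : StateFormula A} (h : MCSat φ) : BinSat φ.toTree := by
  obtain ⟨S, _, M, s₀, hφ⟩ := h
  obtain ⟨e, he⟩ := Countable.exists_injective_nat S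
  let π : List Bool → Option S := fun n => (selectRun e M s₀ n).1
  let t : List Bool → Option A := fun n => (π n).map M.label
  have hhit : ∀ n s, π n = some s → ∀ s', ⨆ K, (treeChain t).hit π K n s' = M.p s s' :=
    fun n s hn s' => iSup_hit_select e M he t s₀ hn s'
  have hsim : Simulates (treeChain t) M π := simulates_of_hit (fun n => rfl) hhit
  refine ⟨t, ?_, (hsim.sat_iff φ (n := []) rfl).2 hφ⟩
  let _ : MeasurableSpace (List Bool) := ⊤
  have : DiscreteMeasurableSpace (List Bool) := ⟨fun _ => trivial⟩
  have hroot : π [] ≠ none := Option.some_ne_none s₀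
  refine (mem_ae_iff_prob_eq_one ((measurableSet_isPath (treeChain t) []).inter
    (measurableSet_sat (treeChain t) recurNonBlank))).1 ?_
  filter_upwards [(treeChain t).ae_isPath [],
    ae_recurrent (fun n hn => exists_visit_eq_one hhit hn) hroot] with w hw hrec
  refine ⟨hw, (sat_recurNonBlank _ _).2 fun k => ?_⟩
  obtain ⟨j, hj⟩ := hrec k
  exact ⟨j, fun hc => hj ((hsim.label_eq_none _).1 hc)⟩

end CTLStar

theorem mainTheorem4 :
    ∃ C : ℕ, ∀ A : Type,
      ∃ f : CTLStar.StateFormula A → CTLStar.StateFormula (Option A),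
        (Finite A → CTLStar.ComputableInLinearTime f C) ∧
        (∀ φ, (f φ).size ≤ C * φ.size ∧ (f φ).dagSize ≤ C * φ.dagSize) ∧
        (∀ φ, CTLStar.MCSat φ ↔ CTLStar.BinSat (f φ)) ∧
        (∀ φ, φ.Qualitative → (f φ).Qualitative) :=
  ⟨20, fun A => ⟨CTLStar.StateFormula.toTree,
    fun _ => CTLStar.computableInLinearTime_toTree A,
    fun φ => ⟨φ.size_toTree_le, φ.dagSize_toTree_le⟩,
    fun _ => ⟨CTLStar.binSat_of_mcSat, CTLStar.mcSat_of_binSat⟩,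
    fun _ h => h.toTree⟩⟩
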